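/- Let $\Sigma$ be a finite alphabet. A (copyless) substitution over a finite set $\mathcal X$ of variables is a map $\sigma:\mathcal X\to(\mathcal X\cup\Sigma)^*$ such that no variable occurs twice in the image of one variable or in the images of two distinct variables; it extends to words morphically, fixing letters, and $(\sigma_1\circ\sigma_2)(X)=\sigma_1(\sigma_2(X))$. A streaming string transducer (SST) over $\Sigma$ consists of a finite nondeterministic automaton reading letters of $\Sigma$, a finite set $\mathcal X$ of variables with a final variable $O$, a substitution for each transition, and a final substitution for each state. A run with transition substitutions $\sigma_1,\dots,\sigma_{n}$ ending in a state with final substitution $\sigma_{n+1}$ has the substitution sequence $\lambda=\sigma_1\cdots\sigma_{n+1}$, and its output $\mathrm{out}(\lambda)$ is $(\sigma_1\circ\cdots\circ\sigma_{n+1})(O)$ with all variables erased. The transduction of an SST is the set of pairs (input, output) of its accepting runs. The SST is functional if its transduction is a partial function, and two SSTs are equivalent, $T\equiv T'$, if they have the same transduction. An SST is rational if $O$ is its only variable and all its updates (including the final ones) have the form $O:=Ou$ with $u\in\Sigma^*$. For a substitution sequence $\lambda$, let $\mathrm{weight}_{j,t}(\lambda)$ be the number of positions $i\le j$ of $\mathrm{out}(\lambda)$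 whose letter is produced by one of the first $t$ substitutions of $\lambda$. For $\ell>0$, a word is cut from left to right into factors, each factor being the longest prefix of the remaining word whose primitive root has length at most $\ell$; the end positions of the factors are the $\ell$-cuts. For $\lambda,\mu$ of the same length with the same output, $$\mathrm{delay}_\ell(\lambda,\mu)=\max_{j\ \ell\text{-cut of }\mathrm{out}(\lambda)}\ \max_{1\le t\le|\lambda|}\bigl|\mathrm{weight}_{j,t}(\lambda)-\mathrm{weight}_{j,t}(\mu)\bigr|$$ (and it is $0$ if the output is empty). $T_1$ is $(k,\ell)$-included in $T_2$ if for every accepting run of $T_1$ on an input $u$, with substitution sequence $\lambda$, there is an accepting run of $T_2$ on $u$, with substitution sequence $\mu$, such that $\mathrm{out}(\lambda)=\mathrm{out}(\mu)$ and $\mathrm{delay}_\ell(\lambda,\mu)\le k$; $T_1\equiv_{k,\ell}T_2$ means $(k,\ell)$-inclusion in both directions. **Corollary.** For every functional SST $T$ over $\Sigma$ there exist integers $k\ge 0$ and $\ell>0$ such that the following are equivalent: (i) there exists a rational SST $T'$ with $T\equiv T'$; (ii) there exists a rational SST $T''$ with $T\equiv_{k,\ell}T''$. -/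

import Mathlib

universe u v w

/-- A map `X → (X ∪ A)*` from variables to words over variables (`Sum.inl`) and letters
(`Sum.inr`). -/
abbrev Subst (X : Type v) (A : Type u) : Type (max u v) := X → List (X ⊕ A)

namespace Subst

variable {X : Type v} {A : Type u}

/-- No variable appears twice in the image of a variable, and no variable appears in the images of
two distinct variables. -/
def Copyless (σ : Subst X A) : Prop :=
  (∀ x, ((σ x).filterMap Sum.getLeft?).Nodup) ∧
    ∀ x y z, x ≠ y → Sum.inl z ∈ σ x → Sum.inl z ∉ σ y

/-- The morphic extension of a substitution to words over variables and letters; it fixes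
letters. -/
def ext (σ : Subst X A) (p : List (X ⊕ A)) : List (X ⊕ A) :=
  p.flatMap (Sum.elim σ (fun a => [Sum.inr a]))

/-- `σ₁ ∘ σ₂`: first apply `σ₂`, then the extension of `σ₁`. -/
def comp (σ₁ σ₂ : Subst X A) : Subst X A := fun x => ext σ₁ (σ₂ x)

/-- The identity substitution. -/
def one : Subst X A := fun x => [Sum.inl x]

/-- The substitution mapping every variable to the empty word. -/
def eps : Subst X A := fun _ => []

/-- `σ₁ ∘ σ₂ ∘ ⋯ ∘ σₘ` for the sequence `σ₁ σ₂ ⋯ σₘ`. -/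
def compSeq (s : List (Subst X A)) : Subst X A := s.foldr comp one

/-- The output `(σ_ε ∘ σ₁ ∘ ⋯ ∘ σₘ)(O)` of a sequence of substitutions. That word contains no
variable; `filterMap` only turns it into a list of letters. -/
def outp (O : X) (s : List (Subst X A)) : List A :=
  (comp eps (compSeq s) O).filterMap Sum.getRight?

/-- Replace every letter in `σ` by the number `t`. -/
def mark (t : ℕ) (σ : Subst X A) : Subst X ℕ :=
  fun x => (σ x).map (Sum.map id (fun _ => t))

/-- The word of origins: its `j`-th letter is the (1-based) index of the substitution of the
sequence that produces the `j`-th letter of the output. -/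
def originWord (O : X) (s : List (Subst X A)) : List ℕ :=
  outp O (s.mapIdx (fun i σ => mark (i + 1) σ))

/-- The number of output positions among the first `j` ones whose origin is at most `t`. -/
def weight (O : X) (s : List (Subst X A)) (j t : ℕ) : ℕ :=
  ((originWord O s).take j).countP (fun i => decide (i ≤ t))

end Subst

/-- Length of the primitive root of `p`, the shortest word `r` such that `p = r ^ n` for some
positive integer `n`. -/
noncomputable def rootLength {A : Type u} (p : List A) : ℕ :=
  sInf {m | ∃ (r : List A) (n : ℕ), 0 < n ∧ p = (List.replicate n r).flatten ∧ r.length = m}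

/-- Length of the longest prefix of `p` whose primitive root has length at most `l`. -/
noncomputable def firstFactorLength {A : Type u} (l : ℕ) (p : List A) : ℕ :=
  Nat.findGreatest (fun n => rootLength (p.take n) ≤ l) p.length

/-- The `l`-factorization of a word (for `l > 0`): repeatedly split off the longest prefix whose
primitive root has length at most `l`. For `l > 0` the recursion stops exactly at the
empty word. -/
noncomputable def factors {A : Type u} (l : ℕ) (p : List A) : List (List A) :=
  if _h : firstFactorLength l p = 0 then []
  else p.take (firstFactorLength l p) :: factors l (p.drop (firstFactorLength l p))
termination_by p.length
decreasing_by
  have h1 : firstFactorLength l p ≤ p.length := Nat.findGreatest_le _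
  rw [List.length_drop]
  omega

/-- The `l`-cuts of a word: the end positions of the factors of its `l`-factorization. -/
noncomputable def cuts {A : Type u} (l : ℕ) (p : List A) : Finset ℕ :=
  ((factors l p).inits.tail.map (fun fs => fs.flatten.length)).toFinset

section Delay

variable {X : Type v} {Y : Type w} {A : Type u}

/-- The weight difference at output position `j` and time `t`. -/
def weightDiff (O : X) (O' : Y) (s : List (Subst X A)) (s' : List (Subst Y A)) (j t : ℕ) : ℕ :=
  ((Subst.weight O s j t : ℤ) - (Subst.weight O' s' j t : ℤ)).natAbs

/-- The maximal weight difference at output position `j`, over all times `1 ≤ t ≤ |s|`. -/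
def maxDiff (O : X) (O' : Y) (s : List (Subst X A)) (s' : List (Subst Y A)) (j : ℕ) : ℕ :=
  (Finset.Icc 1 s.length).sup (weightDiff O O' s s' j)

/-- The `l`-delay (meaningful for sequences of the same length with the same output): the largest
maximal weight difference at an `l`-cut of the output. -/
noncomputable def delay (O : X) (O' : Y) (l : ℕ) (s : List (Subst X A))
    (s' : List (Subst Y A)) : ℕ :=
  (cuts l (Subst.outp O s)).sup (maxDiff O O' s s')

/-- The `(k, l)`-delay resynchronizer: the pairs of sequences of the same length, with the same
output and with `l`-delay at most `k`. The output and the origins of a sequence only involve the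
variables that its own substitutions use, so each component may have its own set of variables and
the two need not be embedded into a common one. -/
def delayResync (O : X) (O' : Y) (k l : ℕ) : Set (List (Subst X A) × List (Subst Y A)) :=
  {p | p.1.length = p.2.length ∧ Subst.outp O p.1 = Subst.outp O' p.2 ∧
    delay O O' l p.1 p.2 ≤ k}

end Delay

/-- A (nondeterministic, copyless) streaming string transducer over the alphabet `A`. Only the
values of `update` on transitions matter. -/
structure SST (A : Type u) : Type (max u (v + 1)) where
  State : Type v
  finite_state : Finite State
  initial : Set State
  trans : Set (State × A × State)
  accepting : Set State
  Var : Type v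
  finite_var : Finite Var
  /-- The final variable. -/
  outVar : Var
  update : State × A × State → Subst Var A
  update_copyless : ∀ e ∈ trans, (update e).Copyless
  finalUpdate : State → Subst Var A
  finalUpdate_copyless : ∀ q, (finalUpdate q).Copyless

namespace SST

variable {A : Type u}

/-- `T.Run p x q s`: there is a run from `p` to `q` on the input `x` whose transitions carry the
sequence of substitutions `s`. -/
inductive Run (T : SST.{u, v} A) :
    T.State → List A → T.State → List (Subst T.Var A) → Prop
  | nil (q : T.State) : Run T q [] q []
  | cons {p q r : T.State} {a : A} {x : List A} {s : List (Subst T.Var A)}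
      (he : (p, a, q) ∈ T.trans) (hr : Run T q x r s) :
      Run T p (a :: x) r (T.update (p, a, q) :: s)

/-- The pairs of an input word and the sequence of substitutions of an accepting run on it; the
sequence ends with the final substitution of the last state. -/
def lang (T : SST.{u, v} A) : Set (List A × List (Subst T.Var A)) :=
  {p | ∃ q₀ ∈ T.initial, ∃ q ∈ T.accepting, ∃ s, T.Run q₀ p.1 q s ∧ p.2 = s ++ [T.finalUpdate q]}

/-- The transduction recognized by `T`. -/
def transduction (T : SST.{u, v} A) : Set (List A × List A) :=
  {p | ∃ s, (p.1, s) ∈ T.lang ∧ Subst.outp T.outVar s = p.2}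

/-- The transduction is a (partial) function. -/
def Functional (T : SST.{u, v} A) : Prop :=
  ∀ x y y', (x, y) ∈ T.transduction → (x, y') ∈ T.transduction → y = y'

/-- Equivalence: both recognize the same transduction. -/
def Equivalent (T : SST.{u, v} A) (T' : SST.{u, w} A) : Prop :=
  T.transduction = T'.transduction

/-- `(k, l)`-inclusion. -/
def DelayIncluded (k l : ℕ) (T : SST.{u, v} A) (T' : SST.{u, w} A) : Prop :=
  ∀ x s, (x, s) ∈ T.lang →
    ∃ s', (x, s') ∈ T'.lang ∧ (s, s') ∈ delayResync T.outVar T'.outVar k l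

/-- `(k, l)`-equivalence. -/
def DelayEquivalent (k l : ℕ) (T : SST.{u, v} A) (T' : SST.{u, w} A) : Prop :=
  DelayIncluded k l T T' ∧ DelayIncluded k l T' T

/-- `σ` is of the form `O := O z` for a word `z` over the alphabet. -/
def AppendOnly {X : Type v} (O : X) (σ : Subst X A) : Prop :=
  ∃ z : List A, σ O = Sum.inl O :: z.map Sum.inr

/-- A rational SST: the only variable is the final variable `O`, and all updates, including the
final ones, are of the form `O := O z`. -/
def IsRational (T : SST.{u, v} A) : Prop :=
  (∀ x : T.Var, x = T.outVar) ∧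
    (∀ e ∈ T.trans, AppendOnly T.outVar (T.update e)) ∧
    ∀ q, AppendOnly T.outVar (T.finalUpdate q)

end SST

/-! Delay equivalence implies equivalence, so (ii) implies (i) for any `k` and `l`. Without an
equivalent rational SST both sides are false and any constants will do. Otherwise fix one equivalent
rational `T'`; it suffices to bound the delay between any accepting runs of `T` and `T'` on the same
input (`exists_delay_le`). The constants may depend on the chosen `T'`.

By time `t` both runs have produced nearly the same total amount (`exists_balance`), and what `T'`
has produced is a prefix of the output, of length `B t`. A large weight difference at `j` therefore
means that `T` still misses many of the first `min j (B t)` letters. They are produced after `t`,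
and Ramsey's theorem on the variable flow finds a loop there whose iteration pumps the output of `T`
at a position at most about `min j (B t)` (`exists_pump`). The loop can be replaced by a bounded one
of the same shape (`exists_short_loop`). Since `T'` appends only, pumping leaves its prefix of
length more than `B t` unchanged, and that prefix must agree with words `P Q^k` for all `k`: the
output has a small period from about `min j (B t)` to beyond `B t`.

If `j ≤ B t`, then `j` is well inside this factor. If `j > B t`, balance forces `T` to have produced
many letters beyond `j` before `t`; the mirrored argument (`exists_pump_suffix`) gives a small
period from `B t` to beyond `j`, and the two factors overlap enough to merge. In both cases `j` is
well inside a factor of small period, where the greedy factorization has no cut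
(`PeriodicOn.not_mem_cuts`). -/

namespace Subst

/-! ### Words over variables and letters, origins, copyless substitutions -/

section Words

variable {X : Type*} {A : Type*} {B : Type*}

/-- Replace every variable of a word by a word of letters. -/
def ev (f : X → List A) (W : List (X ⊕ A)) : List A :=
  W.flatMap (Sum.elim f fun a => [a])

/-- The variables of a word. -/
def vars (W : List (X ⊕ A)) : List X := W.filterMap Sum.getLeft?

/-- The number of letters of a word. -/
def lc (W : List (X ⊕ A)) : ℕ := W.countP Sum.isRight

/-- Apply a map to the letters of a substitution. -/
def mapLetters (g : A → B) (σ : Subst X A) : Subst X B := fun x => (σ x).map (Sum.map id g)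

@[simp] theorem ev_nil (f : X → List A) : ev f [] = [] := rfl

@[simp] theorem ev_append (f : X → List A) (U V : List (X ⊕ A)) :
    ev f (U ++ V) = ev f U ++ ev f V := by simp [ev]

@[simp] theorem ev_cons_inl (f : X → List A) (x : X) (V : List (X ⊕ A)) :
    ev f (Sum.inl x :: V) = f x ++ ev f V := by simp [ev]

@[simp] theorem ev_cons_inr (f : X → List A) (a : A) (V : List (X ⊕ A)) :
    ev f (Sum.inr a :: V) = a :: ev f V := by simp [ev]

@[simp] theorem ext_nil (σ : Subst X A) : ext σ [] = [] := rfl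

@[simp] theorem ext_append (σ : Subst X A) (U V : List (X ⊕ A)) :
    ext σ (U ++ V) = ext σ U ++ ext σ V := by simp [ext]

@[simp] theorem ext_cons_inl (σ : Subst X A) (x : X) (V : List (X ⊕ A)) :
    ext σ (Sum.inl x :: V) = σ x ++ ext σ V := by simp [ext]

@[simp] theorem ext_cons_inr (σ : Subst X A) (a : A) (V : List (X ⊕ A)) :
    ext σ (Sum.inr a :: V) = Sum.inr a :: ext σ V := by simp [ext]

@[simp] theorem vars_nil : vars ([] : List (X ⊕ A)) = [] := rfl

@[simp] theorem vars_append (U V : List (X ⊕ A)) : vars (U ++ V) = vars U ++ vars V := by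
  simp [vars]

@[simp] theorem vars_cons_inl (x : X) (V : List (X ⊕ A)) :
    vars (Sum.inl x :: V) = x :: vars V := by simp [vars]

@[simp] theorem vars_cons_inr (a : A) (V : List (X ⊕ A)) :
    vars (Sum.inr a :: V) = vars V := rfl

@[simp] theorem lc_nil : lc ([] : List (X ⊕ A)) = 0 := rfl

@[simp] theorem lc_append (U V : List (X ⊕ A)) : lc (U ++ V) = lc U + lc V := by simp [lc]

@[simp] theorem lc_cons_inl (x : X) (V : List (X ⊕ A)) : lc (Sum.inl x :: V) = lc V := by
  simp [lc]

@[simp] theorem lc_cons_inr (a : A) (V : List (X ⊕ A)) : lc (Sum.inr a :: V) = lc V + 1 :=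
  List.countP_cons_of_pos rfl

@[simp] theorem mem_vars {x : X} {W : List (X ⊕ A)} : x ∈ vars W ↔ Sum.inl x ∈ W := by
  simp [vars]

theorem mem_ext_inl {σ : Subst X A} {z : X} {W : List (X ⊕ A)} :
    Sum.inl z ∈ ext σ W ↔ ∃ y, Sum.inl y ∈ W ∧ Sum.inl z ∈ σ y := by
  simp [ext]

theorem ev_ext (f : X → List A) (σ : Subst X A) (W : List (X ⊕ A)) :
    ev f (ext σ W) = ev (fun x => ev f (σ x)) W := by
  induction W with
  | nil => rfl
  | cons z W ih => cases z <;> simp [ih]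

theorem ext_comp (σ τ : Subst X A) (W : List (X ⊕ A)) :
    ext (comp σ τ) W = ext σ (ext τ W) := by
  induction W with
  | nil => rfl
  | cons z W ih => cases z <;> simp [ih, comp]

theorem ext_one (W : List (X ⊕ A)) : ext one W = W := by
  induction W with
  | nil => rfl
  | cons z W ih => cases z <;> simp [ih, one]

theorem vars_ext (σ : Subst X A) (W : List (X ⊕ A)) :
    vars (ext σ W) = (vars W).flatMap (fun x => vars (σ x)) := by
  induction W with
  | nil => rfl
  | cons z W ih => cases z <;> simp [ih]

theorem lc_ext (σ : Subst X A) (W : List (X ⊕ A)) :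
    lc (ext σ W) = lc W + ((vars W).map (fun x => lc (σ x))).sum := by
  induction W with
  | nil => rfl
  | cons z W ih => cases z <;> simp [ih] <;> omega

theorem length_ev (f : X → List A) (W : List (X ⊕ A)) :
    (ev f W).length = lc W + ((vars W).map (fun x => (f x).length)).sum := by
  induction W with
  | nil => rfl
  | cons z W ih => cases z <;> simp [ih] <;> omega

theorem ext_of_vars_eq_nil (σ : Subst X A) {W : List (X ⊕ A)} (h : vars W = []) :
    ext σ W = W := by
  induction W with
  | nil => rfl
  | cons z W ih => cases z <;> simp_all

theorem compSeq_append (s t : List (Subst X A)) :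
    compSeq (s ++ t) = comp (compSeq s) (compSeq t) := by
  induction s with
  | nil => funext x; simp [compSeq, comp, ext_one]
  | cons σ s ih =>
    have h : compSeq (σ :: s ++ t) = comp σ (compSeq (s ++ t)) := rfl
    have h' : compSeq (σ :: s) = comp σ (compSeq s) := rfl
    funext x
    rw [h, h', ih]
    simp only [comp, ext_comp]

theorem compSeq_singleton (σ : Subst X A) : compSeq [σ] = σ := by
  funext x; simp [compSeq, comp, one]

theorem outp_eq_ev (O : X) (s : List (Subst X A)) :
    outp O s = ev (fun _ => []) (compSeq s O) := by
  have h : ∀ W : List (X ⊕ A), (ext eps W).filterMap Sum.getRight? = ev (fun _ => []) W := by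
    intro W
    induction W with
    | nil => rfl
    | cons z W ih => cases z <;> simp [ih, eps]
  exact h _

/-- This cuts a run into past and future: the future is a word over the variables, in which the
values built by the past are inserted. -/
theorem outp_append (O : X) (s t : List (Subst X A)) :
    outp O (s ++ t) = ev (fun x => outp x s) (compSeq t O) := by
  rw [outp_eq_ev, compSeq_append, comp, ev_ext]
  congr 1
  funext x
  rw [outp_eq_ev]

theorem ext_mapLetters (g : A → B) (σ : Subst X A) (W : List (X ⊕ A)) :
    ext (mapLetters g σ) (W.map (Sum.map id g)) = (ext σ W).map (Sum.map id g) := by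
  induction W with
  | nil => rfl
  | cons z W ih => cases z <;> simp [ih, mapLetters]

theorem compSeq_mapLetters (g : A → B) (s : List (Subst X A)) (x : X) :
    compSeq (s.map (mapLetters g)) x = (compSeq s x).map (Sum.map id g) := by
  induction s generalizing x with
  | nil => simp [compSeq, one]
  | cons σ s ih =>
    have h : ∀ y, compSeq ((σ :: s).map (mapLetters g)) y =
      ext (mapLetters g σ) (compSeq (s.map (mapLetters g)) y) := fun _ => rfl
    rw [h, ih, ext_mapLetters]
    rfl

theorem outp_mapLetters (g : A → B) (s : List (Subst X A)) (x : X) :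
    outp x (s.map (mapLetters g)) = (outp x s).map g := by
  rw [outp_eq_ev, outp_eq_ev, compSeq_mapLetters]
  generalize compSeq s x = W
  induction W with
  | nil => rfl
  | cons z W ih => cases z <;> simp [ih]

/-- The word of `ev f W` with every letter replaced by whether it comes from a variable. -/
def tags (f : X → List A) (W : List (X ⊕ A)) : List Bool :=
  W.flatMap (Sum.elim (fun x => List.replicate (f x).length true) fun _ => [false])

theorem length_tags (f : X → List A) (W : List (X ⊕ A)) :
    (tags f W).length = (ev f W).length := by
  induction W with
  | nil => rfl
  | cons z W ih => cases z <;> simp_all [tags]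

/-- Relabelling letters commutes with composition, so origins may be coarsened to "past or future"
before evaluation. A past letter is one that comes from the value of a variable in the word built by
`t`. -/
theorem originWord_tags (O : X) (s t : List (Subst X A)) :
    (originWord O (s ++ t)).map (fun i => decide (i ≤ s.length)) =
      tags (fun x => outp x s) (compSeq t O) := by
  have h1 : ((s ++ t).mapIdx (fun i σ => mark (i + 1) σ)).map
      (mapLetters (fun i => decide (i ≤ s.length))) =
      s.map (mapLetters (fun _ => true)) ++ t.map (mapLetters (fun _ => false)) := by
    rw [List.mapIdx_append, List.map_append]
    congr 1
    · apply List.ext_getElem (by simp)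
      intro i h1 h2
      simp at h1
      simp only [List.getElem_map, List.getElem_mapIdx]
      funext x
      have : i + 1 ≤ s.length := h1
      simp [mapLetters, mark, this]
    · apply List.ext_getElem (by simp)
      intro i h1 h2
      simp only [List.getElem_map, List.getElem_mapIdx]
      funext x
      have : ¬ (i + s.length + 1 ≤ s.length) := by omega
      simp [mapLetters, mark, this]
  unfold originWord
  rw [← outp_mapLetters, h1, outp_append, compSeq_mapLetters]
  simp only [outp_mapLetters]
  generalize compSeq t O = W
  induction W with
  | nil => rfl
  | cons z W ih => cases z <;> simp_all [tags]

theorem Copyless.nodup_vars_ext {σ : Subst X A} (hσ : σ.Copyless) {W : List (X ⊕ A)}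
    (hW : (vars W).Nodup) : (vars (ext σ W)).Nodup := by
  rw [vars_ext, List.nodup_flatMap]
  refine ⟨fun x _ => hσ.1 x, ?_⟩
  refine hW.imp ?_
  intro x y hxy
  rw [Function.onFun, List.disjoint_left]
  intro z hz hz'
  exact hσ.2 x y z hxy (mem_vars.1 hz) (mem_vars.1 hz')

theorem Copyless.comp {σ τ : Subst X A} (hσ : σ.Copyless) (hτ : τ.Copyless) :
    (comp σ τ).Copyless := by
  refine ⟨fun x => hσ.nodup_vars_ext (hτ.1 x), ?_⟩
  intro x y z hxy hx hy
  obtain ⟨x', hx', hzx⟩ := mem_ext_inl.1 hx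
  obtain ⟨y', hy', hzy⟩ := mem_ext_inl.1 hy
  by_cases h : x' = y'
  · subst h
    exact hτ.2 x y x' hxy hx' hy'
  · exact hσ.2 x' y' z h hzx hzy

theorem copyless_one : (one : Subst X A).Copyless := by
  refine ⟨fun x => by simp [one], ?_⟩
  intro x y z hxy hx hy
  simp [one] at hx hy
  exact hxy (hx ▸ hy)

theorem copyless_compSeq {s : List (Subst X A)} (hs : ∀ σ ∈ s, σ.Copyless) :
    (compSeq s).Copyless := by
  induction s with
  | nil => exact copyless_one
  | cons σ s ih =>
    exact Copyless.comp (hs σ (by simp)) (ih fun τ hτ => hs τ (by simp [hτ]))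

/-- A substitution adds at most `n` letters to every word without repeated variables. -/
def Adds (n : ℕ) (σ : Subst X A) : Prop :=
  ∀ W : List (X ⊕ A), (vars W).Nodup → lc (ext σ W) ≤ lc W + n

/-- Without repeated variables each image `σ x` is inserted at most once, so the total number of
letters in all images is a bound. -/
theorem exists_adds [Finite X] (σ : Subst X A) : ∃ n, Adds n σ := by
  classical
  cases nonempty_fintype X
  refine ⟨∑ x, lc (σ x), fun W hW => ?_⟩
  rw [lc_ext, ← List.sum_toFinset _ hW]
  gcongr
  exact Finset.subset_univ _

theorem Adds.lc_le {n : ℕ} {σ : Subst X A} (h : Adds n σ) (x : X) : lc (σ x) ≤ n := by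
  simpa using h [Sum.inl x] (by simp)

theorem Adds.mono {m n : ℕ} {σ : Subst X A} (h : Adds m σ) (hmn : m ≤ n) : Adds n σ :=
  fun W hW => (h W hW).trans (by omega)

end Words

end Subst

/-- Locates the block that contains a marked entry of a concatenation. It traces a letter or
variable back to the symbol whose image produced it. -/
theorem List.exists_of_flatMap_eq_append_cons {α β : Type*} {f : α → List β} {l : List α}
    {s t : List β} {b : β} (h : l.flatMap f = s ++ b :: t) :
    ∃ l₁ a l₂ p q, l = l₁ ++ a :: l₂ ∧ f a = p ++ b :: q ∧ s = l₁.flatMap f ++ p ∧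
      t = q ++ l₂.flatMap f := by
  induction l generalizing s with
  | nil => simp at h
  | cons a l ih =>
    rw [List.flatMap_cons, List.append_eq_append_iff] at h
    rcases h with ⟨r, h1, h2⟩ | ⟨r, h1, h2⟩
    · obtain ⟨l₁, a', l₂, p, q, e1, e2, e3, e4⟩ := ih h2
      exact ⟨a :: l₁, a', l₂, p, q, by simp [e1], e2, by simp [h1, e3], e4⟩
    · cases r with
      | nil =>
        simp at h1 h2
        obtain ⟨l₁, a', l₂, p, q, e1, e2, e3, e4⟩ := ih (s := []) h2.symm
        exact ⟨a :: l₁, a', l₂, p, q, by simp [e1], e2, by simp_all, e4⟩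
      | cons c r =>
        simp at h2
        obtain ⟨rfl, rfl⟩ := h2
        exact ⟨[], a, l, s, r, by simp, h1, by simp, by simp⟩

namespace Subst

/-! ### Iterating a substitution with idempotent flow -/

section Pumping

variable {X : Type*} {A : Type*}

/-- A letter occurs to the left of `x` in `σ x`. -/
def LetterLeft (σ : Subst X A) (x : X) : Prop :=
  ∃ l r a, σ x = l ++ Sum.inl x :: r ∧ Sum.inr a ∈ l

/-- A letter occurs to the right of `x` in `σ x`. -/
def LetterRight (σ : Subst X A) (x : X) : Prop :=
  ∃ l r a, σ x = l ++ Sum.inl x :: r ∧ Sum.inr a ∈ r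

/-- The variable flow of a substitution, and the variables that it extends on the left and on
the right. -/
def shape (σ : Subst X A) : (X → X → Prop) × (X → Prop) × (X → Prop) :=
  (fun x y => Sum.inl y ∈ σ x, LetterLeft σ, LetterRight σ)

theorem mem_iff_of_shape_eq {σ τ : Subst X A} (h : shape σ = shape τ) (x y : X) :
    Sum.inl y ∈ σ x ↔ Sum.inl y ∈ τ x :=
  iff_of_eq (congrFun (congrFun (congrArg Prod.fst h) x) y)

theorem letterLeft_iff_of_shape_eq {σ τ : Subst X A} (h : shape σ = shape τ) (x : X) :
    LetterLeft σ x ↔ LetterLeft τ x :=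
  iff_of_eq (congrFun (congrArg (fun p => p.2.1) h) x)

theorem letterRight_iff_of_shape_eq {σ τ : Subst X A} (h : shape σ = shape τ) (x : X) :
    LetterRight σ x ↔ LetterRight τ x :=
  iff_of_eq (congrFun (congrArg (fun p => p.2.2) h) x)

/-- The value of `x` in the word `ev f W` ends at or before position `c`. -/
def EndLE (f : X → List A) (W : List (X ⊕ A)) (c : ℕ) (x : X) : Prop :=
  ∃ U, U <+: W ∧ Sum.inl x ∈ U ∧ (ev f U).length ≤ c

/-- The value of `x` in the word `ev f W` starts at or before position `c`. -/
def StartLE (f : X → List A) (W : List (X ⊕ A)) (c : ℕ) (x : X) : Prop :=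
  ∃ U, U ++ [Sum.inl x] <+: W ∧ (ev f U).length ≤ c

/-- The variable flow of a copyless substitution with idempotent flow. -/
structure IdemFlow (σ : Subst X A) : Prop where
  self_mem : ∀ x y, Sum.inl y ∈ σ x → Sum.inl x ∈ σ x
  dead : ∀ x y, Sum.inl y ∈ σ x → y ≠ x → vars (σ y) = []

theorem length_ev_mono (f : X → List A) {U V : List (X ⊕ A)} (h : U <+: V) :
    (ev f U).length ≤ (ev f V).length := by
  obtain ⟨t, rfl⟩ := h
  simp

theorem lc_mono {U V : List (X ⊕ A)} (h : U <+: V) : lc U ≤ lc V := by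
  obtain ⟨t, rfl⟩ := h
  simp

/-- By `hflow`, the variables of `ext σ V` all lie in the longest prefix of `W` with value of length
at most `c`. By copylessness none is repeated, so their values and the letters of `V` fit into `c`,
and `σ` adds at most `n` letters. -/
theorem length_ev_ext_le_of_prefix {σ : Subst X A} (hσ : σ.Copyless) {n : ℕ} (hn : Adds n σ)
    {f : X → List A} {W V : List (X ⊕ A)} {c : ℕ} (hW : (vars W).Nodup) (hV : V <+: W)
    (hVc : (ev f V).length ≤ c)
    (hflow : ∀ x y, EndLE f W c x → Sum.inl y ∈ σ x → EndLE f W c y) :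
    (ev f (ext σ V)).length ≤ c + n := by
  classical
  let p : ℕ → Prop := fun m => (ev f (W.take m)).length ≤ c
  let m := Nat.findGreatest p W.length
  have hm : p m := Nat.findGreatest_spec (P := p) (m := 0) (Nat.zero_le _) (by simp [p])
  have hle : ∀ U, U <+: W → (ev f U).length ≤ c → U <+: W.take m := by
    intro U hU hUc
    have hU' := List.prefix_iff_eq_take.1 hU
    have : U.length ≤ m := by
      refine Nat.le_findGreatest hU.length_le ?_
      change (ev f (W.take U.length)).length ≤ c
      rwa [← hU']
    rw [hU']
    exact List.take_prefix_take_left this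
  have hVm := hle V hV hVc
  have hsub : vars (ext σ V) ⊆ vars (W.take m) := by
    intro y hy
    rw [mem_vars, mem_ext_inl] at hy
    obtain ⟨x, hx, hy⟩ := hy
    obtain ⟨U, hU, hyU, hUc⟩ := hflow x y ⟨V, hV, hx, hVc⟩ hy
    exact mem_vars.2 ((hle U hU hUc).subset hyU)
  have hVn : (vars V).Nodup := by
    obtain ⟨t, rfl⟩ := hV
    rw [vars_append] at hW
    exact hW.of_append_left
  have hnd := hσ.nodup_vars_ext hVn
  have hmn : (vars (W.take m)).Nodup := by
    rw [← List.take_append_drop m W, vars_append] at hW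
    exact hW.of_append_left
  have hsum : ((vars (ext σ V)).map (fun x => (f x).length)).sum ≤
      ((vars (W.take m)).map (fun x => (f x).length)).sum := by
    rw [← List.sum_toFinset _ hnd, ← List.sum_toFinset _ hmn]
    apply Finset.sum_le_sum_of_subset
    intro y hy
    rw [List.mem_toFinset] at hy ⊢
    exact hsub hy
  have hm' : (ev f (W.take m)).length ≤ c := hm
  rw [length_ev] at hm' ⊢
  have h1 := hn V hVn
  have h2 := lc_mono hVm
  omega

theorem iterate_ext_append (σ : Subst X A) (n : ℕ) (U V : List (X ⊕ A)) :
    (ext σ)^[n] (U ++ V) = (ext σ)^[n] U ++ (ext σ)^[n] V := by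
  induction n generalizing U V with
  | zero => rfl
  | succ n ih => simp [ih]

theorem vars_ext_of_dead {σ : Subst X A} {W : List (X ⊕ A)}
    (h : ∀ y, Sum.inl y ∈ W → vars (σ y) = []) : vars (ext σ W) = [] := by
  rw [vars_ext, List.flatMap_eq_nil_iff]
  intro y hy
  exact h y (mem_vars.1 hy)

theorem ext_flatten_replicate {σ : Subst X A} {L : List (X ⊕ A)} (h : vars L = []) (n : ℕ) :
    ext σ (List.replicate n L).flatten = (List.replicate n L).flatten := by
  apply ext_of_vars_eq_nil
  induction n with
  | zero => rfl
  | succ n ih => simp [List.replicate_succ, h, ih]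

theorem ev_flatten_replicate (f : X → List A) (L : List (X ⊕ A)) (n : ℕ) :
    ev f (List.replicate n L).flatten = (List.replicate n (ev f L)).flatten := by
  induction n with
  | zero => rfl
  | succ n ih => simp [List.replicate_succ, ih]

theorem flatten_replicate_append_comm {α : Type*} (L : List α) (n : ℕ) :
    (List.replicate n L).flatten ++ L = L ++ (List.replicate n L).flatten := by
  have h := List.replicate_succ' (n := n) (a := L)
  rw [List.replicate_succ] at h
  have := congrArg List.flatten h
  simpa using this.symm

theorem dead_of_split {σ : Subst X A} (hσ : σ.Copyless) (hi : IdemFlow σ) {x : X}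
    {l r : List (X ⊕ A)} (h : σ x = l ++ Sum.inl x :: r) :
    (∀ y, Sum.inl y ∈ l → vars (σ y) = []) ∧ ∀ y, Sum.inl y ∈ r → vars (σ y) = [] := by
  have hnd : (vars (σ x)).Nodup := hσ.1 x
  rw [h] at hnd
  simp [List.nodup_append] at hnd
  constructor
  · intro y hy
    refine hi.dead x y (by simp [h, hy]) ?_
    rintro rfl
    exact (hnd.2.2 y hy).1 rfl
  · intro y hy
    refine hi.dead x y (by simp [h, hy]) ?_
    rintro rfl
    exact hnd.2.1.1 hy

/-- The variables beside `x` in `σ x` are dead, so `ext σ l` and `ext σ r` consist of letters only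
and each further iteration puts one more copy of them around `σ x`. -/
theorem iterate_ext_of_split {σ : Subst X A} (hσ : σ.Copyless) (hi : IdemFlow σ) {x : X}
    {l r : List (X ⊕ A)} (h : σ x = l ++ Sum.inl x :: r) (n : ℕ) :
    (ext σ)^[n + 1] [Sum.inl x] =
      (List.replicate n (ext σ l)).flatten ++ σ x ++ (List.replicate n (ext σ r)).flatten := by
  obtain ⟨hl, hr⟩ := dead_of_split hσ hi h
  induction n with
  | zero => simp
  | succ n ih =>
    rw [Function.iterate_succ_apply', ih, ext_append, ext_append,
      ext_flatten_replicate (vars_ext_of_dead hl), ext_flatten_replicate (vars_ext_of_dead hr)]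
    have : ext σ (σ x) = ext σ l ++ σ x ++ ext σ r := by
      conv_lhs => rw [h]
      simp
    rw [this, List.replicate_succ, List.replicate_succ, List.flatten_cons, List.flatten_cons,
      ← flatten_replicate_append_comm (ext σ l)]
    simp only [List.append_assoc]

/-- Iterating the substitution makes the value of `x` longer. -/
def Pumped (σ : Subst X A) (x : X) : Prop :=
  ∃ l r, σ x = l ++ Sum.inl x :: r ∧ (ext σ l ≠ [] ∨ ext σ r ≠ [])

theorem ext_ne_nil_of_letter_mem {σ : Subst X A} {l : List (X ⊕ A)} {a : A}
    (h : Sum.inr a ∈ l) : ext σ l ≠ [] := by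
  intro h'
  have : (Sum.inr a : X ⊕ A) ∈ ext σ l := by
    obtain ⟨s, t, rfl⟩ := List.append_of_mem h
    simp
  simp [h'] at this

/-- Either `x` survives with nothing added around it after one iteration, or `σ x` contains no
variable at all. -/
theorem ext_ext_of_not_pumped {σ : Subst X A} (hσ : σ.Copyless) (hi : IdemFlow σ) {x : X}
    (h : ¬ Pumped σ x) : ext σ (σ x) = σ x := by
  by_cases hx : Sum.inl x ∈ σ x
  · obtain ⟨l, r, hlr⟩ := List.append_of_mem hx
    have h' := iterate_ext_of_split hσ hi hlr 1
    have hl : ext σ l = [] := by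
      by_contra hl
      exact h ⟨l, r, hlr, Or.inl hl⟩
    have hr : ext σ r = [] := by
      by_contra hr
      exact h ⟨l, r, hlr, Or.inr hr⟩
    simpa [hl, hr] using h'
  · apply ext_of_vars_eq_nil
    rw [List.eq_nil_iff_forall_not_mem]
    intro y hy
    exact hx (hi.self_mem x y (mem_vars.1 hy))

theorem iterate_ext_of_not_pumped {σ : Subst X A} (hσ : σ.Copyless) (hi : IdemFlow σ)
    {W : List (X ⊕ A)} (h : ∀ x, Sum.inl x ∈ W → ¬ Pumped σ x) (n : ℕ) :
    (ext σ)^[n + 1] W = ext σ W := by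
  have h1 : ext σ (ext σ W) = ext σ W := by
    induction W with
    | nil => rfl
    | cons z W ih =>
      cases z with
      | inl x =>
        simp [ext_ext_of_not_pumped hσ hi (h x (by simp)), ih fun y hy => h y (by simp [hy])]
      | inr a => simp [ih fun y hy => h y (by simp [hy])]
  induction n with
  | zero => rfl
  | succ n ih => rw [Function.iterate_succ_apply', ih, h1]

theorem length_ev_ext_le {σ : Subst X A} (hσ : σ.Copyless) {n : ℕ} (hn : Adds n σ)
    (f : X → List A) {x : X} {l m r : List (X ⊕ A)} (h : σ x = l ++ m ++ r)
    (hm : ∀ y, Sum.inl y ∈ m → vars (σ y) = []) : (ev f (ext σ m)).length ≤ 2 * n := by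
  have hnd : (vars (σ x)).Nodup := hσ.1 x
  rw [h, vars_append, vars_append] at hnd
  rw [length_ev, vars_ext_of_dead hm]
  have h1 := hn m hnd.of_append_left.of_append_right
  have h2 := hn.lc_le x
  simp [h] at h2
  simp
  omega

/-- Everything before the first pumped variable of `W` is constant from the first iteration on. So
the iterates begin with a fixed word `P` followed by powers of the block that accumulates beside
this variable. -/
theorem exists_pumped_prefix {σ : Subst X A} (hσ : σ.Copyless) (hi : IdemFlow σ) {n : ℕ}
    (hn : Adds n σ) {f : X → List A} {W : List (X ⊕ A)} {c : ℕ} (hW : (vars W).Nodup)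
    (hflow : ∀ x y, EndLE f W c x → Sum.inl y ∈ σ x → EndLE f W c y)
    (hp : ∃ x, (StartLE f W c x ∧ LetterLeft σ x) ∨ (EndLE f W c x ∧ LetterRight σ x)) :
    ∃ P Q : List A, Q ≠ [] ∧ Q.length ≤ 2 * n ∧ P.length ≤ c + n ∧
      ∀ k, P ++ (List.replicate k Q).flatten <+: ev f ((ext σ)^[k + 1] W) := by
  classical
  obtain ⟨x₀, hx₀⟩ := hp
  have hx₀W : Sum.inl x₀ ∈ W := by
    rcases hx₀ with ⟨⟨U, hU, -⟩, -⟩ | ⟨⟨U, hU, hm, -⟩, -⟩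
    · exact hU.subset (by simp)
    · exact hU.subset hm
  have hx₀P : Pumped σ x₀ := by
    rcases hx₀ with ⟨-, l, r, a, h, ha⟩ | ⟨-, l, r, a, h, ha⟩
    · exact ⟨l, r, h, Or.inl (ext_ne_nil_of_letter_mem ha)⟩
    · exact ⟨l, r, h, Or.inr (ext_ne_nil_of_letter_mem ha)⟩
  obtain ⟨W₁, x, W₂, rfl, hxP, hW₁⟩ : ∃ W₁ x W₂, W = W₁ ++ Sum.inl x :: W₂ ∧ Pumped σ x ∧
      ∀ y, Sum.inl y ∈ W₁ → ¬ Pumped σ y := by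
    let p : X ⊕ A → Bool := Sum.elim (fun x => decide (Pumped σ x)) fun _ => false
    obtain ⟨z, hz⟩ : ∃ z, W.find? p = some z := by
      rw [← Option.isSome_iff_exists, List.find?_isSome]
      exact ⟨_, hx₀W, by simpa [p] using hx₀P⟩
    rw [List.find?_eq_some_iff_append] at hz
    obtain ⟨hz, W₁, W₂, hWe, hW₁⟩ := hz
    cases z with
    | inr a => simp [p] at hz
    | inl x =>
      refine ⟨W₁, x, W₂, hWe, by simpa [p] using hz, fun y hy => ?_⟩
      simpa [p] using hW₁ _ hy
  -- The first pumped variable is at or to the left of the witness `x₀`, hence inherits its position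
  -- bound. If only the start of `x₀` is bounded and the two coincide, the letter to the left of
  -- `x₀` is used.
  have key : (ev f W₁).length ≤ c ∧ ((∃ l r, σ x = l ++ Sum.inl x :: r ∧ ext σ l ≠ []) ∨
      (ev f (W₁ ++ [Sum.inl x])).length ≤ c) := by
    have hp1 : W₁ <+: W₁ ++ Sum.inl x :: W₂ := List.prefix_append _ _
    have hp2 : W₁ ++ [Sum.inl x] <+: W₁ ++ Sum.inl x :: W₂ := ⟨W₂, by simp⟩
    rcases hx₀ with ⟨⟨U, hU, hUc⟩, l, r, a, h, ha⟩ | ⟨⟨U, hU, hm, hUc⟩, -⟩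
    · have hlen : W₁.length ≤ U.length := by
        by_contra hlt
        have := List.prefix_of_prefix_length_le hU hp1 (by simp; omega)
        exact hW₁ x₀ (this.subset (by simp)) hx₀P
      have hU' : U <+: W₁ ++ Sum.inl x :: W₂ := (List.prefix_append _ _).trans hU
      have h1 := List.prefix_of_prefix_length_le hp1 hU' hlen
      refine ⟨(length_ev_mono f h1).trans hUc, ?_⟩
      rcases hlen.eq_or_lt with heq | hlt
      · left
        have h2 := List.prefix_of_prefix_length_le hp2 hU (by simp [heq])
        have h3 := h2.eq_of_length (by simp [heq])
        have h4 := List.append_inj_right' h3 rfl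
        simp at h4
        subst h4
        exact ⟨l, r, h, ext_ne_nil_of_letter_mem ha⟩
      · right
        have h2 := List.prefix_of_prefix_length_le hp2 hU' (by simpa using hlt)
        exact (length_ev_mono f h2).trans hUc
    · have hlen : W₁.length < U.length := by
        by_contra hlt
        have := List.prefix_of_prefix_length_le hU hp1 (by omega)
        exact hW₁ x₀ (this.subset hm) hx₀P
      have h2 := List.prefix_of_prefix_length_le hp2 hU (by simpa using hlen)
      exact ⟨(length_ev_mono f ((List.prefix_append _ _).trans h2)).trans hUc,
        Or.inr ((length_ev_mono f h2).trans hUc)⟩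
  obtain ⟨hW₁c, hx⟩ := key
  by_cases hleft : ∃ l r, σ x = l ++ Sum.inl x :: r ∧ ext σ l ≠ []
  · obtain ⟨l, r, hlr, hl⟩ := hleft
    obtain ⟨hld, hrd⟩ := dead_of_split hσ hi hlr
    refine ⟨ev f (ext σ W₁), ev f (ext σ l), ?_,
      length_ev_ext_le hσ hn f (l := []) (by simpa using hlr) hld,
      length_ev_ext_le_of_prefix hσ hn hW (List.prefix_append _ _) hW₁c hflow, ?_⟩
    · intro h0
      have hv := vars_ext_of_dead hld
      cases hL : ext σ l with
      | nil => exact hl hL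
      | cons z t => cases z <;> simp [hL] at hv h0
    · intro k
      rw [show W₁ ++ Sum.inl x :: W₂ = W₁ ++ ([Sum.inl x] ++ W₂) from rfl,
        iterate_ext_append, iterate_ext_append, iterate_ext_of_not_pumped hσ hi hW₁,
        iterate_ext_of_split hσ hi hlr]
      simp only [ev_append, ev_flatten_replicate, List.append_assoc]
      exact ⟨_, by rw [List.append_assoc]⟩
  -- Nothing accumulates on the left of `x`, so `x` itself joins the constant part and the powers
  -- come from its right side.
  · have hxc := hx.resolve_left hleft
    obtain ⟨l, r, hlr, hP⟩ := hxP
    have hl : ext σ l = [] := by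
      by_contra hl
      exact hleft ⟨l, r, hlr, hl⟩
    have hr : ext σ r ≠ [] := hP.resolve_left (by simp [hl])
    obtain ⟨hld, hrd⟩ := dead_of_split hσ hi hlr
    refine ⟨ev f (ext σ (W₁ ++ [Sum.inl x])), ev f (ext σ r), ?_,
      length_ev_ext_le hσ hn f (l := l ++ [Sum.inl x]) (r := []) (by simpa using hlr) hrd,
      length_ev_ext_le_of_prefix hσ hn hW ⟨W₂, by simp⟩ hxc hflow, ?_⟩
    · intro h0
      have hv := vars_ext_of_dead hrd
      cases hL : ext σ r with
      | nil => exact hr hL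
      | cons z t => cases z <;> simp [hL] at hv h0
    · intro k
      rw [show W₁ ++ Sum.inl x :: W₂ = W₁ ++ ([Sum.inl x] ++ W₂) from rfl,
        iterate_ext_append, iterate_ext_append, iterate_ext_of_not_pumped hσ hi hW₁,
        iterate_ext_of_split hσ hi hlr]
      simp only [ev_append, ev_flatten_replicate, List.append_assoc, hl, ext_append,
        ext_cons_inl, ext_nil, List.append_nil]
      refine ⟨ev f ((ext σ)^[k + 1] W₂), ?_⟩
      simp

end Pumping

end Subst

/-! ### Monochromatic triangles and the loops they provide -/

/-- Ramsey's theorem for monochromatic triangles. -/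
theorem exists_monochromatic_triangle (K : Type*) [Finite K] :
    ∃ N : ℕ, ∀ f : ℕ → ℕ → K, ∃ i j k, i < j ∧ j < k ∧ k ≤ N ∧ f i j = f i k ∧ f j k = f i k := by
  classical
  cases nonempty_fintype K
  have key : ∀ m : ℕ, ∃ R : ℕ, ∀ (f : ℕ → ℕ → K) (C : Finset K) (S : Finset ℕ), C.card = m →
      R ≤ S.card → (∀ i ∈ S, ∀ j ∈ S, i < j → f i j ∈ C) →
      ∃ i ∈ S, ∃ j ∈ S, ∃ k ∈ S, i < j ∧ j < k ∧ f i j = f i k ∧ f j k = f i k := by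
    intro m
    induction m with
    | zero =>
      refine ⟨2, fun f C S hC hS hf => ?_⟩
      obtain ⟨i, hi, j, hj, hij⟩ := Finset.one_lt_card.1 hS
      rw [Finset.card_eq_zero] at hC
      subst hC
      rcases lt_or_gt_of_ne hij with h | h
      · exact absurd (hf i hi j hj h) (by simp)
      · exact absurd (hf j hj i hi h) (by simp)
    | succ m ih =>
      obtain ⟨R, hR⟩ := ih
      refine ⟨(m + 1) * R + 2, fun f C S hC hS hf => ?_⟩
      have hne : S.Nonempty := Finset.card_pos.1 (by omega)
      set v := S.min' hne with hv
      have hvS : v ∈ S := S.min'_mem hne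
      have hlt : ∀ i ∈ S.erase v, v < i := fun i hi =>
        lt_of_le_of_ne (S.min'_le i (Finset.mem_of_mem_erase hi)) (Finset.ne_of_mem_erase hi).symm
      obtain ⟨a, ha, hcard⟩ := Finset.exists_lt_card_fiber_of_mul_lt_card_of_maps_to
        (s := S.erase v) (t := C) (f := fun i => f v i) (n := R)
        (fun i hi => hf v hvS i (Finset.mem_of_mem_erase hi) (hlt i hi))
        (by rw [hC, Finset.card_erase_of_mem hvS]; omega)
      set S' := (S.erase v).filter (fun i => f v i = a) with hS'
      have hmem : ∀ i ∈ S', i ∈ S ∧ v < i ∧ f v i = a := by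
        intro i hi
        rw [hS', Finset.mem_filter] at hi
        exact ⟨Finset.mem_of_mem_erase hi.1, hlt i hi.1, hi.2⟩
      by_cases h : ∃ i ∈ S', ∃ j ∈ S', i < j ∧ f i j = a
      · obtain ⟨i, hi, j, hj, hij, hfa⟩ := h
        refine ⟨v, hvS, i, (hmem i hi).1, j, (hmem j hj).1, (hmem i hi).2.1, hij, ?_, ?_⟩
        · rw [(hmem i hi).2.2, (hmem j hj).2.2]
        · rw [hfa, (hmem j hj).2.2]
      · push Not at h
        obtain ⟨i, hi, j, hj, k, hk, h1, h2, h3, h4⟩ := hR f (C.erase a) S'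
          (by rw [Finset.card_erase_of_mem ha, hC]; rfl) hcard.le
          (fun i hi j hj hij => Finset.mem_erase.2
            ⟨h i hi j hj hij, hf i (hmem i hi).1 j (hmem j hj).1 hij⟩)
        exact ⟨i, (hmem i hi).1, j, (hmem j hj).1, k, (hmem k hk).1, h1, h2, h3, h4⟩
  obtain ⟨R, hR⟩ := key (Fintype.card K)
  refine ⟨R, fun f => ?_⟩
  obtain ⟨i, -, j, -, k, hk, h1, h2, h3, h4⟩ := hR f Finset.univ (Finset.range (R + 1)) rfl
    (by simp) (fun _ _ _ _ _ => Finset.mem_univ _)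
  exact ⟨i, j, k, h1, h2, by simpa [Nat.lt_succ_iff] using hk, h3, h4⟩

namespace Subst

section Triangle

variable {X : Type*} {A : Type*}

/-- If `y` occurs in `σ x`, it also does so after composition, through some `z` in `τ x`;
copylessness of `σ` forces `z = x`. Likewise, a variable reaching `x` through some `y ≠ x` would
occur in both `σ x` and `σ y`. -/
theorem idemFlow_of_shape_eq {σ τ σ' : Subst X A} (hσ : σ.Copyless) (h : shape τ = shape σ)
    (hc : shape (comp σ τ) = shape σ) (h' : shape σ' = shape σ) : IdemFlow σ' := by
  constructor
  · intro x y hy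
    rw [mem_iff_of_shape_eq h'] at hy ⊢
    have hy' := hy
    rw [← mem_iff_of_shape_eq hc] at hy'
    obtain ⟨z, hz, hyz⟩ := mem_ext_inl.1 hy'
    have : x = z := by
      by_contra hne
      exact hσ.2 x z y hne hy hyz
    subst this
    rwa [mem_iff_of_shape_eq h] at hz
  · intro x y hy hne
    rw [List.eq_nil_iff_forall_not_mem]
    intro z hz
    rw [mem_vars, mem_iff_of_shape_eq h'] at hz
    rw [mem_iff_of_shape_eq h'] at hy
    have hzx : Sum.inl z ∈ σ x := by
      rw [← mem_iff_of_shape_eq hc]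
      exact mem_ext_inl.2 ⟨y, (mem_iff_of_shape_eq h x y).2 hy, hz⟩
    exact hσ.2 x y z hne.symm hzx hz

/-- The letter produced by `σ` among the first `c` positions must be seen beside a variable that
survives iteration. Equal shapes then transfer this to `σ'`, and the equal start and end predicates
transfer the position bounds to `W₀`. -/
theorem exists_pumped_prefix_of_triangle {σ τ : Subst X A} {f₀ f₁ f₂ : X → List A}
    {W₀ W₁ W₂ : List (X ⊕ A)} {c : ℕ} (hσ : σ.Copyless)
    (hW₁ : W₁ = ext τ W₂) (hW₀ : W₀ = ext σ W₁) (hf₁ : f₁ = fun x => ev f₀ (σ x))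
    (hf₂ : f₂ = fun x => ev f₁ (τ x)) (hnd : (vars W₀).Nodup) (hshape : shape τ = shape σ)
    (hcomp : shape (comp σ τ) = shape σ)
    (hs₁ : StartLE f₁ W₁ c = StartLE f₀ W₀ c) (hs₂ : StartLE f₂ W₂ c = StartLE f₀ W₀ c)
    (he₁ : EndLE f₁ W₁ c = EndLE f₀ W₀ c)
    (hinc : ∃ U x V p a q, W₁ = U ++ Sum.inl x :: V ∧ σ x = p ++ Sum.inr a :: q ∧
      (ev f₀ (ext σ U ++ p)).length ≤ c)
    {σ' : Subst X A} (hσ' : σ'.Copyless) (h' : shape σ' = shape σ) {n : ℕ} (hn : Adds n σ') :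
    ∃ P Q : List A, Q ≠ [] ∧ Q.length ≤ 2 * n ∧ P.length ≤ c + n ∧
      ∀ k, P ++ (List.replicate k Q).flatten <+: ev f₀ ((ext σ')^[k + 1] W₀) := by
  have hiτ : IdemFlow τ := idemFlow_of_shape_eq hσ hshape hcomp hshape
  refine exists_pumped_prefix hσ' (idemFlow_of_shape_eq hσ hshape hcomp h') hn hnd ?_ ?_
  · intro x y hx hy
    rw [← he₁] at hx
    obtain ⟨U, hU, hxU, hUc⟩ := hx
    refine ⟨ext σ U, ?_, mem_ext_inl.2 ⟨x, hxU, (mem_iff_of_shape_eq h' x y).1 hy⟩, ?_⟩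
    · obtain ⟨t, rfl⟩ := hU
      exact ⟨ext σ t, by rw [hW₀, ext_append]⟩
    · rw [ev_ext, ← hf₁]
      exact hUc
  · obtain ⟨U, x, V, p, a, q, hU, hx, hc⟩ := hinc
    have hUc : (ev f₁ U).length ≤ c := by
      rw [hf₁, ← ev_ext]
      simp at hc
      omega
    simp only [letterLeft_iff_of_shape_eq h', letterRight_iff_of_shape_eq h']
    by_cases hxx : Sum.inl x ∈ σ x
    · have hmem := hxx
      rw [hx] at hmem
      simp only [List.mem_append, List.mem_cons, reduceCtorEq, false_or] at hmem
      rcases hmem with hmem | hmem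
      · obtain ⟨p₁, p₂, rfl⟩ := List.append_of_mem hmem
        refine ⟨x, Or.inr ⟨⟨ext σ U ++ (p₁ ++ [Sum.inl x]), ⟨p₂ ++ Sum.inr a :: q ++ ext σ V, ?_⟩,
          by simp, ?_⟩, p₁, p₂ ++ Sum.inr a :: q, a, by simp [hx], by simp⟩⟩
        · rw [hW₀, hU]
          simp [hx]
        · simp at hc ⊢
          omega
      · obtain ⟨q₁, q₂, rfl⟩ := List.append_of_mem hmem
        refine ⟨x, Or.inl ⟨?_, p ++ Sum.inr a :: q₁, q₂, a, by simp [hx], by simp⟩⟩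
        rw [← hs₁]
        exact ⟨U, ⟨V, by simp [hU]⟩, hUc⟩
    -- Here `x` dies under iteration. It is used by some `y` in `τ y`, and `y` survives by
    -- idempotency; the letter is then beside `y` in `comp σ τ`, which has the shape of `σ`.
    · obtain ⟨W, y, W', l, r, hW, hy, hUe, hVe⟩ :=
        List.exists_of_flatMap_eq_append_cons (hW₁.symm.trans hU)
      cases y with
      | inr b =>
        have : (Sum.inl x : X ⊕ A) ∈ [Sum.inr b] := by
          have : [Sum.inr b] = l ++ Sum.inl x :: r := hy
          rw [this]; simp
        simp at this
      | inl y =>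
        simp only [Sum.elim_inl] at hy
        have hxy : Sum.inl x ∈ τ y := by simp [hy]
        have hyy := hiτ.self_mem y x hxy
        have hyσ : Sum.inl y ∈ σ y := (mem_iff_of_shape_eq hshape y y).1 hyy
        have hne : y ≠ x := by
          rintro rfl
          exact hxx hyσ
        obtain ⟨s, t, hst⟩ := List.append_of_mem hyσ
        have hUe' : U = ext τ W ++ l := hUe
        have hmem := hyy
        rw [hy] at hmem
        simp only [List.mem_append, List.mem_cons, Sum.inl.injEq, hne, false_or] at hmem
        rcases hmem with hmem | hmem
        · obtain ⟨l₁, l₂, rfl⟩ := List.append_of_mem hmem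
          refine ⟨y, Or.inr ⟨?_, ?_⟩⟩
          · rw [← he₁]
            refine ⟨ext τ W ++ (l₁ ++ [Sum.inl y]), ⟨l₂ ++ Sum.inl x :: V, ?_⟩, by simp, ?_⟩
            · rw [hU, hUe']
              simp
            · rw [hUe'] at hUc
              simp at hUc ⊢
              omega
          · rw [← letterRight_iff_of_shape_eq hcomp]
            refine ⟨ext σ l₁ ++ s, t ++ ext σ l₂ ++ (p ++ Sum.inr a :: q) ++ ext σ r, a, ?_,
              by simp⟩
            rw [comp, hy]
            simp [hst, hx]
        · obtain ⟨r₁, r₂, rfl⟩ := List.append_of_mem hmem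
          refine ⟨y, Or.inl ⟨?_, ?_⟩⟩
          · rw [← hs₂]
            refine ⟨W, ⟨W', by simp [hW]⟩, ?_⟩
            rw [hf₂, ← ev_ext]
            rw [hUe'] at hUc
            simp at hUc
            omega
          · rw [← letterLeft_iff_of_shape_eq hcomp]
            refine ⟨ext σ l ++ (p ++ Sum.inr a :: q) ++ ext σ r₁ ++ s, t ++ ext σ r₂, a, ?_,
              by simp⟩
            rw [comp, hy]
            simp [hst, hx]

end Triangle

end Subst

/-- A discrete intermediate value theorem for functions with bounded increments. -/
theorem exists_between_of_increment_le {f : ℕ → ℕ} {D lo hi M : ℕ} (hlh : lo ≤ hi)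
    (hstep : ∀ t, lo ≤ t → t < hi → f (t + 1) ≤ f t + D) (hM : f lo + M ≤ f hi) :
    ∃ t, lo ≤ t ∧ t ≤ hi ∧ f lo + M ≤ f t ∧ f t ≤ f lo + M + D := by
  classical
  have hex : ∃ t, lo ≤ t ∧ f lo + M ≤ f t := ⟨hi, hlh, hM⟩
  obtain ⟨h1, h2⟩ := Nat.find_spec hex
  have h3 : Nat.find hex ≤ hi := Nat.find_min' hex ⟨hlh, hM⟩
  refine ⟨Nat.find hex, h1, h3, h2, ?_⟩
  rcases h1.eq_or_lt with h | h
  · rw [← h]; omega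
  · have hm := Nat.find_min hex (m := Nat.find hex - 1) (by omega)
    have hs := hstep (Nat.find hex - 1) (by omega) (by omega)
    rw [Nat.sub_add_cancel (by omega)] at hs
    have : ¬ (f lo + M ≤ f (Nat.find hex - 1)) := fun h' => hm ⟨by omega, h'⟩
    omega

namespace Subst

/-! ### Weights along a run and the pumping lemma -/

section Sequences

variable {X : Type*} {A : Type*}

/-- The part of a sequence between two times. -/
def seg (s : List (Subst X A)) (i j : ℕ) : List (Subst X A) := (s.drop i).take (j - i)

theorem take_append_seg (s : List (Subst X A)) {i j : ℕ} (h : i ≤ j) :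
    s.take i ++ seg s i j = s.take j := by
  rw [seg, ← List.take_add, Nat.add_sub_cancel' h]

theorem seg_append_drop (s : List (Subst X A)) {i j : ℕ} (h : i ≤ j) :
    seg s i j ++ s.drop j = s.drop i := by
  have := List.take_append_drop (j - i) (s.drop i)
  rwa [List.drop_drop, Nat.add_sub_cancel' h] at this

theorem seg_append_seg (s : List (Subst X A)) {i j k : ℕ} (hij : i ≤ j) (hjk : j ≤ k) :
    seg s i j ++ seg s j k = seg s i k := by
  have h : k - i = (j - i) + (k - j) := by omega
  rw [seg, seg, seg, h, List.take_add, List.drop_drop, Nat.add_sub_cancel' hij]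

/-- The values of the variables after the first `t` substitutions. -/
def val (s : List (Subst X A)) (t : ℕ) : X → List A := fun x => outp x (s.take t)

/-- The word over variables and letters that the substitutions after the first `t` ones build. -/
def tailWord (O : X) (s : List (Subst X A)) (t : ℕ) : List (X ⊕ A) := compSeq (s.drop t) O

theorem outp_eq_ev_val (O : X) (s : List (Subst X A)) (t : ℕ) :
    outp O s = ev (val s t) (tailWord O s t) := by
  conv_lhs => rw [← List.take_append_drop t s]
  exact outp_append _ _ _

theorem val_eq (s : List (Subst X A)) {i j : ℕ} (h : i ≤ j) :
    val s j = fun x => ev (val s i) (compSeq (seg s i j) x) := by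
  funext x
  rw [val, ← take_append_seg s h, outp_append]
  rfl

theorem tailWord_eq (O : X) (s : List (Subst X A)) {i j : ℕ} (h : i ≤ j) :
    tailWord O s i = ext (compSeq (seg s i j)) (tailWord O s j) := by
  rw [tailWord, ← seg_append_drop s h, compSeq_append]
  rfl

theorem nodup_vars_tailWord (O : X) {s : List (Subst X A)} (hs : ∀ σ ∈ s, σ.Copyless) (t : ℕ) :
    (vars (tailWord O s t)).Nodup :=
  (copyless_compSeq fun σ hσ => hs σ (List.mem_of_mem_drop hσ)).1 O

theorem length_originWord (O : X) (s : List (Subst X A)) :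
    (originWord O s).length = (outp O s).length := by
  have h := congrArg List.length (originWord_tags O [] s)
  rw [length_tags] at h
  have h' := outp_eq_ev_val O s 0
  simp only [List.nil_append, List.length_map] at h
  rw [h, h']
  rfl

theorem map_originWord (O : X) (s : List (Subst X A)) {t : ℕ} (ht : t ≤ s.length) :
    (originWord O s).map (fun i => decide (i ≤ t)) = tags (val s t) (tailWord O s t) := by
  have h := originWord_tags O (s.take t) (s.drop t)
  rwa [List.take_append_drop, List.length_take_of_le ht] at h

theorem countP_tags (f : X → List A) (W : List (X ⊕ A)) :
    (tags f W).countP id + lc W = (ev f W).length := by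
  induction W with
  | nil => rfl
  | cons z W ih =>
    cases z with
    | inl x =>
      have : tags f (Sum.inl x :: W) = List.replicate (f x).length true ++ tags f W := rfl
      rw [this, List.countP_append, List.countP_replicate]
      simp
      omega
    | inr a =>
      have : tags f (Sum.inr a :: W) = false :: tags f W := rfl
      rw [this]
      simp
      omega

/-- The letters of the tail word are exactly the output letters not yet produced at time `t`. -/
theorem weight_add_lc (O : X) (s : List (Subst X A)) {j t : ℕ} (ht : t ≤ s.length)
    (hj : (outp O s).length ≤ j) :
    weight O s j t + lc (tailWord O s t) = (outp O s).length := by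
  have h := countP_tags (val s t) (tailWord O s t)
  rw [← map_originWord O s ht, List.countP_map, ← outp_eq_ev_val] at h
  rw [weight, List.take_of_length_le (by rwa [length_originWord])]
  exact h

theorem weight_mono (O : X) (s : List (Subst X A)) (j : ℕ) {t t' : ℕ} (h : t ≤ t') :
    weight O s j t ≤ weight O s j t' := by
  apply List.countP_mono_left
  intro i _ hi
  simp at hi ⊢
  omega

theorem weight_mono_left (O : X) (s : List (Subst X A)) {i j : ℕ} (h : i ≤ j) (t : ℕ) :
    weight O s i t ≤ weight O s j t :=
  (List.take_sublist_take_left h).countP_le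

/-- The difference of the two sides counts the positions between `i` and `j` with origin between `t`
and `t'`. It bounds growth on a prefix by growth on a longer prefix. -/
theorem weight_increment_mono (O : X) (s : List (Subst X A)) {i j : ℕ} (h : i ≤ j) {t t' : ℕ}
    (ht : t ≤ t') : weight O s i t' + weight O s j t ≤ weight O s i t + weight O s j t' := by
  have hsplit : ∀ r, weight O s j r = weight O s i r +
      (((originWord O s).drop i).take (j - i)).countP (fun m => decide (m ≤ r)) := by
    intro r
    rw [weight, weight, ← List.countP_append, ← List.take_add, Nat.add_sub_cancel' h]
  rw [hsplit, hsplit]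
  have : (((originWord O s).drop i).take (j - i)).countP (fun m => decide (m ≤ t)) ≤
      (((originWord O s).drop i).take (j - i)).countP (fun m => decide (m ≤ t')) := by
    apply List.countP_mono_left
    intro i _ hi
    simp at hi ⊢
    omega
  omega

theorem weight_le_add_sub (O : X) (s : List (Subst X A)) {i j : ℕ} (h : i ≤ j) (t : ℕ) :
    weight O s j t ≤ weight O s i t + (j - i) := by
  rw [weight, weight]
  conv_lhs => rw [← Nat.add_sub_cancel' h, List.take_add, List.countP_append]
  gcongr
  exact List.countP_le_length.trans (List.length_take_le _ _)

theorem weight_le (O : X) (s : List (Subst X A)) (j t : ℕ) : weight O s j t ≤ j :=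
  List.countP_le_length.trans (List.length_take_le _ _)

theorem weight_succ_le (O : X) {s : List (Subst X A)} (hs : ∀ σ ∈ s, σ.Copyless) {D : ℕ}
    (hD : ∀ σ ∈ s, Adds D σ) (j : ℕ) {t : ℕ} (ht : t < s.length) :
    weight O s j (t + 1) ≤ weight O s j t + D := by
  have key : ∀ j, (outp O s).length ≤ j → weight O s j (t + 1) ≤ weight O s j t + D := by
    intro j hj
    have h1 := weight_add_lc O s ht.le hj
    have h2 := weight_add_lc O s (t := t + 1) ht hj
    have h3 : seg s t (t + 1) = [s[t]] := by
      rw [seg, List.drop_eq_getElem_cons ht, Nat.add_sub_cancel_left]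
      rfl
    have h4 := hD s[t] (List.getElem_mem ht) _ (nodup_vars_tailWord O hs (t + 1))
    rw [tailWord_eq O s (Nat.le_succ t), Nat.succ_eq_add_one, h3, compSeq_singleton] at h1
    omega
  rcases le_total (outp O s).length j with h | h
  · exact key j h
  · have h1 := key _ le_rfl
    have h2 := weight_increment_mono O s h (Nat.le_succ t)
    rw [Nat.succ_eq_add_one] at h2
    omega

/-- Some letter among the first `c` positions has its origin in the segment; it is traced through
the tail words at the two times. -/
theorem exists_letter_of_weight_lt (O : X) (s : List (Subst X A)) {c i j : ℕ} (hij : i ≤ j)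
    (hj : j ≤ s.length) (h : weight O s c i < weight O s c j) :
    ∃ U x V p a q, tailWord O s j = U ++ Sum.inl x :: V ∧
      compSeq (seg s i j) x = p ++ Sum.inr a :: q ∧
      (ev (val s i) (ext (compSeq (seg s i j)) U ++ p)).length ≤ c := by
  obtain ⟨m, hm, hmj, hmi⟩ : ∃ m ∈ (originWord O s).take c, m ≤ j ∧ ¬ m ≤ i := by
    by_contra hcon
    push Not at hcon
    refine absurd h (not_lt.2 (List.countP_mono_left ?_))
    intro m hm hmj
    simp at hmj ⊢
    exact hcon m hm hmj
  obtain ⟨B₁, B₂, hB⟩ := List.append_of_mem hm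
  have hB₁ : B₁.length < c := by
    have := congrArg List.length hB
    simp at this
    omega
  have hB' : originWord O s = B₁ ++ m :: (B₂ ++ (originWord O s).drop c) := by
    conv_lhs => rw [← List.take_append_drop c (originWord O s), hB]
    simp
  have hi := map_originWord O s (hij.trans hj)
  have hj' := map_originWord O s hj
  rw [hB', List.map_append, List.map_cons] at hi hj'
  simp only [hmj, hmi, decide_true, decide_false] at hi hj'
  obtain ⟨l₁, y, l₂, p, q, hW, hy, hB₁', -⟩ := List.exists_of_flatMap_eq_append_cons hi.symm
  have hlen : B₁.length = (ev (val s i) l₁).length + p.length := by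
    rw [← length_tags, ← List.length_map (as := B₁), hB₁', List.length_append]
    rfl
  cases y with
  | inl x =>
    have : false ∈ List.replicate (val s i x).length true := by
      have h' : List.replicate (val s i x).length true = p ++ false :: q := hy
      rw [h']; simp
    simp at this
  | inr a =>
    rw [tailWord_eq O s hij] at hW
    obtain ⟨U, z, V, p', q', hU, hz, hl, -⟩ := List.exists_of_flatMap_eq_append_cons hW
    cases z with
    | inl x =>
      refine ⟨U, x, V, p', a, q', hU, hz, ?_⟩
      have : ext (compSeq (seg s i j)) U ++ p' = l₁ := hl.symm
      rw [this]
      omega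
    | inr b =>
      have hp : p = [] := by
        have := congrArg List.length hy
        simp at this
        exact List.eq_nil_of_length_eq_zero (by omega)
      have hp' : p' = [] := by
        have := congrArg List.length hz
        simp at this
        exact List.eq_nil_of_length_eq_zero (by omega)
      subst hp hp'
      have hl' : l₁ = ext (compSeq (seg s i j)) U := by rw [hl, List.append_nil]; rfl
      rw [hl', ev_ext, ← val_eq s hij, ← length_tags] at hlen
      -- A letter of the tail word at time `j` would have an origin later than `j`, contrary to the
      -- choice of `m`.
      rw [hU] at hj'
      have : tags (val s j) (U ++ Sum.inr b :: V) =
        tags (val s j) U ++ false :: tags (val s j) V := by simp [tags]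
      rw [this] at hj'
      have := List.append_inj_right hj' (by simpa using hlen)
      simp at this

/-- If many letters of the first `c` positions of the output are produced between two times, then
there is a factor between them whose iteration prolongs the output from a position that is
essentially at most `c` on. -/
theorem exists_pump (X : Type*) [Finite X] (K : Type*) [Finite K] : ∃ N : ℕ, ∀ {A : Type*} (O : X)
    (s : List (Subst X A)) (c D lo hi : ℕ) (q : ℕ → K), (∀ σ ∈ s, σ.Copyless) →
    (∀ σ ∈ s, Adds D σ) → lo ≤ hi → hi ≤ s.length →
    weight O s c lo + N * (D + 1) ≤ weight O s c hi →
    ∃ i j, lo ≤ i ∧ i < j ∧ j ≤ hi ∧ q i = q j ∧ ∀ (σ' : Subst X A) (n : ℕ), σ'.Copyless →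
      shape σ' = shape (compSeq (seg s i j)) → Adds n σ' →
      ∃ P Q : List A, Q ≠ [] ∧ Q.length ≤ 2 * n ∧ P.length ≤ c + n ∧
        ∀ k, P ++ (List.replicate k Q).flatten <+:
          ev (val s i) ((ext σ')^[k + 1] (tailWord O s i)) := by
  obtain ⟨N, hN⟩ := exists_monochromatic_triangle
    (((X → X → Prop) × (X → Prop) × (X → Prop)) × (K × (X → Prop) × (X → Prop)) ×
      (K × (X → Prop) × (X → Prop)))
  refine ⟨N, fun {A} O s c D lo hi q hs hD hlh hhi hw => ?_⟩
  -- Spacing `D + 1` exceeds the overshoot `D` of a single substitution, so the weight strictly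
  -- increases along the chosen times.
  have hg : ∀ m, m ≤ N → ∃ t, lo ≤ t ∧ t ≤ hi ∧ weight O s c lo + m * (D + 1) ≤ weight O s c t ∧
      weight O s c t ≤ weight O s c lo + m * (D + 1) + D := by
    intro m hm
    refine exists_between_of_increment_le hlh
      (fun t _ ht => weight_succ_le O hs hD c (ht.trans_le hhi)) ?_
    have := Nat.mul_le_mul_right (D + 1) hm
    omega
  choose! g hlo hhi' hge hle using hg
  have hlt : ∀ a b, a < b → b ≤ N → weight O s c (g a) < weight O s c (g b) := by
    intro a b hab hb
    have h1 := hle a (by omega)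
    have h2 := hge b hb
    have h3 : (a + 1) * (D + 1) ≤ b * (D + 1) := Nat.mul_le_mul_right _ hab
    rw [Nat.succ_mul] at h3
    omega
  have hglt : ∀ a b, a < b → b ≤ N → g a < g b := by
    intro a b hab hb
    by_contra hcon
    have := weight_mono O s c (not_lt.1 hcon)
    have := hlt a b hab hb
    omega
  let vc : ℕ → K × (X → Prop) × (X → Prop) := fun t =>
    (q t, StartLE (val s t) (tailWord O s t) c, EndLE (val s t) (tailWord O s t) c)
  -- Putting the data of both endpoints into the colour of an edge makes the three vertices of a
  -- monochromatic triangle agree as well.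
  obtain ⟨a, b, d, hab, hbd, hdN, h1, h2⟩ :=
    hN fun a b => (shape (compSeq (seg s (g a) (g b))), vc (g a), vc (g b))
  have hgab := hglt a b hab (by omega)
  have hgbd := hglt b d hbd hdN
  have e1 := congrArg (fun p => p.1) h1
  have e2 := congrArg (fun p => p.1) h2
  have v1 := congrArg (fun p => p.2.2) h1
  have v2 := congrArg (fun p => p.2.1) h2
  simp only at e1 e2 v1 v2
  have vs : ∀ {t t'}, vc t = vc t' → q t = q t' ∧
      StartLE (val s t) (tailWord O s t) c = StartLE (val s t') (tailWord O s t') c ∧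
      EndLE (val s t) (tailWord O s t) c = EndLE (val s t') (tailWord O s t') c := by
    intro t t' h
    exact ⟨congrArg (fun p => p.1) h, congrArg (fun p => p.2.1) h, congrArg (fun p => p.2.2) h⟩
  obtain ⟨q1, s1, x1⟩ := vs v1
  obtain ⟨q2, s2, x2⟩ := vs v2
  refine ⟨g a, g b, hlo a (by omega), hgab, hhi' b (by omega), q2.symm, ?_⟩
  intro σ' n hσ' hsh hn
  have hcomp : comp (compSeq (seg s (g a) (g b))) (compSeq (seg s (g b) (g d))) =
      compSeq (seg s (g a) (g d)) := by
    rw [← compSeq_append, seg_append_seg s hgab.le hgbd.le]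
  refine exists_pumped_prefix_of_triangle (σ := compSeq (seg s (g a) (g b)))
    (τ := compSeq (seg s (g b) (g d))) (W₂ := tailWord O s (g d)) (f₂ := val s (g d))
    (copyless_compSeq fun σ hσ => hs σ (List.mem_of_mem_drop (List.mem_of_mem_take hσ)))
    (tailWord_eq O s hgbd.le) (tailWord_eq O s hgab.le) (val_eq s hgab.le) (val_eq s hgbd.le)
    (nodup_vars_tailWord O hs _) (e2.trans e1.symm) ?_ s2 ?_ x2 ?_ hσ' hsh hn
  · rw [hcomp]; exact e1.symm
  · exact s1.symm.trans s2
  · exact exists_letter_of_weight_lt O s hgab.le ((hhi' b (by omega)).trans hhi)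
      (hlt a b hab (by omega))

end Sequences

end Subst

namespace Subst

/-! ### Mirror images: pumping at the end of the output -/

section Reverse

variable {X : Type*} {A : Type*}

/-- The mirror image of a substitution. -/
def mirror (σ : Subst X A) : Subst X A := fun x => (σ x).reverse

@[simp] theorem mirror_mirror (σ : Subst X A) : mirror (mirror σ) = σ := by
  funext x; simp [mirror]

theorem ext_mirror (σ : Subst X A) (W : List (X ⊕ A)) :
    ext (mirror σ) W.reverse = (ext σ W).reverse := by
  induction W with
  | nil => rfl
  | cons z W ih => cases z <;> simp [ih, mirror]

theorem ev_reverse (f : X → List A) (W : List (X ⊕ A)) :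
    ev (fun x => (f x).reverse) W.reverse = (ev f W).reverse := by
  induction W with
  | nil => rfl
  | cons z W ih => cases z <;> simp [ih]

theorem compSeq_mirror (s : List (Subst X A)) : compSeq (s.map mirror) = mirror (compSeq s) := by
  induction s with
  | nil => funext x; simp [compSeq, mirror, one]
  | cons σ s ih =>
    funext x
    have h : compSeq ((σ :: s).map mirror) x = ext (mirror σ) (compSeq (s.map mirror) x) := rfl
    have h' : mirror (compSeq (σ :: s)) x = (ext σ (compSeq s x)).reverse := rfl
    rw [h, h', ih, ← ext_mirror]
    rfl

theorem outp_mirror (O : X) (s : List (Subst X A)) :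
    outp O (s.map mirror) = (outp O s).reverse := by
  rw [outp_eq_ev, outp_eq_ev, compSeq_mirror, ← ev_reverse]
  rfl

theorem originWord_mirror (O : X) (s : List (Subst X A)) :
    originWord O (s.map mirror) = (originWord O s).reverse := by
  rw [originWord, originWord, ← outp_mirror]
  congr 1
  apply List.ext_getElem (by simp)
  intro i h1 h2
  simp only [List.getElem_mapIdx, List.getElem_map]
  funext x
  simp [mark, mirror]

theorem vars_reverse (W : List (X ⊕ A)) : vars W.reverse = (vars W).reverse := by
  simp [vars, List.filterMap_reverse]

theorem lc_reverse (W : List (X ⊕ A)) : lc W.reverse = lc W := by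
  simp [lc]

theorem Copyless.mirror {σ : Subst X A} (h : σ.Copyless) : (mirror σ).Copyless := by
  refine ⟨fun x => ?_, ?_⟩
  · have := vars_reverse (σ x)
    change (vars (σ x).reverse).Nodup
    rw [this, List.nodup_reverse]
    exact h.1 x
  · intro x y z hxy
    simp only [Subst.mirror, List.mem_reverse]
    exact h.2 x y z hxy

theorem Adds.mirror {n : ℕ} {σ : Subst X A} (h : Adds n σ) : Adds n (mirror σ) := by
  intro W hW
  have h1 := ext_mirror σ W.reverse
  rw [List.reverse_reverse] at h1
  rw [h1, lc_reverse, ← lc_reverse W]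
  apply h
  rwa [vars_reverse, List.nodup_reverse]

theorem letterLeft_mirror (σ : Subst X A) : LetterLeft (mirror σ) = LetterRight σ := by
  funext x
  apply propext
  constructor
  · rintro ⟨l, r, a, h, ha⟩
    refine ⟨r.reverse, l.reverse, a, ?_, by simpa using ha⟩
    have := congrArg List.reverse h
    simpa [mirror] using this
  · rintro ⟨l, r, a, h, ha⟩
    exact ⟨r.reverse, l.reverse, a, by simp [mirror, h], by simpa using ha⟩

theorem letterRight_mirror (σ : Subst X A) : LetterRight (mirror σ) = LetterLeft σ := by
  rw [← letterLeft_mirror, mirror_mirror]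

theorem shape_mirror (σ : Subst X A) :
    shape (mirror σ) = ((shape σ).1, (shape σ).2.2, (shape σ).2.1) := by
  simp only [shape, letterLeft_mirror, letterRight_mirror, Prod.mk.injEq, and_true]
  simp [mirror]

theorem weight_mirror (O : X) (s : List (Subst X A)) {c : ℕ}
    (t : ℕ) : weight O (s.map mirror) c t + weight O s ((outp O s).length - c) t =
      weight O s (outp O s).length t := by
  have hl := length_originWord O s
  rw [weight, weight, weight, originWord_mirror, List.take_reverse, List.countP_reverse, hl,
    add_comm, ← List.countP_append, List.take_append_drop, List.take_of_length_le hl.le]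

theorem iterate_ext_mirror (σ : Subst X A) (n : ℕ) (W : List (X ⊕ A)) :
    (ext (mirror σ))^[n] W.reverse = ((ext σ)^[n] W).reverse := by
  induction n generalizing W with
  | zero => rfl
  | succ n ih => rw [Function.iterate_succ_apply, Function.iterate_succ_apply, ext_mirror, ih]

theorem reverse_flatten_replicate {α : Type*} (k : ℕ) (L : List α) :
    (List.replicate k L).flatten.reverse = (List.replicate k L.reverse).flatten := by
  simp [List.reverse_flatten]

/-- The mirror image of `exists_pump`. -/
theorem exists_pump_suffix (X : Type*) [Finite X] (K : Type*) [Finite K] :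
    ∃ N : ℕ, ∀ {A : Type*} (O : X)
    (s : List (Subst X A)) (c D lo hi : ℕ) (q : ℕ → K), (∀ σ ∈ s, σ.Copyless) →
    (∀ σ ∈ s, Adds D σ) → lo ≤ hi → hi ≤ s.length →
    weight O (s.map mirror) c lo + N * (D + 1) ≤ weight O (s.map mirror) c hi →
    ∃ i j, lo ≤ i ∧ i < j ∧ j ≤ hi ∧ q i = q j ∧ ∀ (σ' : Subst X A) (n : ℕ), σ'.Copyless →
      shape σ' = shape (compSeq (seg s i j)) → Adds n σ' →
      ∃ P Q : List A, Q ≠ [] ∧ Q.length ≤ 2 * n ∧ P.length ≤ c + n ∧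
        ∀ k, (List.replicate k Q).flatten ++ P <:+
          ev (val s i) ((ext σ')^[k + 1] (tailWord O s i)) := by
  obtain ⟨N, hN⟩ := exists_pump X K
  refine ⟨N, fun {A} O s c D lo hi q hs hD hlh hhi hw => ?_⟩
  obtain ⟨i, j, hi, hij, hj, hq, h⟩ := hN O (s.map mirror) c D lo hi q
    (by simpa using fun σ hσ => (hs σ hσ).mirror) (by simpa using fun σ hσ => (hD σ hσ).mirror)
    hlh (by simpa using hhi) hw
  refine ⟨i, j, hi, hij, hj, hq, fun σ' n hσ' hsh hn => ?_⟩
  obtain ⟨P, Q, hQ, hQn, hP, hk⟩ := h (mirror σ') n hσ'.mirror (by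
    rw [seg, ← List.map_drop, ← List.map_take, compSeq_mirror, shape_mirror, shape_mirror, hsh]
    rfl) hn.mirror
  refine ⟨P.reverse, Q.reverse, by simpa using hQ, by simpa using hQn, by simpa using hP,
    fun k => ?_⟩
  have hval : val (s.map mirror) i = fun x => (val s i x).reverse := by
    funext x
    rw [val, ← List.map_take, outp_mirror]
    rfl
  have htail : tailWord O (s.map mirror) i = (tailWord O s i).reverse := by
    rw [tailWord, ← List.map_drop, compSeq_mirror]
    rfl
  have := hk k
  rw [hval, htail, iterate_ext_mirror, ev_reverse, ← List.reverse_suffix, List.reverse_reverse,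
    List.reverse_append, reverse_flatten_replicate] at this
  exact this

end Reverse

end Subst

/-! ### Periodic factors and cuts -/

section Periods

variable {A : Type*}

/-- The factor of `w` between the positions `p` and `q` has period `d`. -/
def PeriodicOn (w : List A) (p q d : ℕ) : Prop :=
  ∀ i, p ≤ i → i + d < q → w[i]? = w[i + d]?

theorem PeriodicOn.mono {w : List A} {p q p' q' d : ℕ} (h : PeriodicOn w p q d) (hp : p ≤ p')
    (hq : q' ≤ q) : PeriodicOn w p' q' d :=
  fun i hi hi' => h i (hp.trans hi) (hi'.trans_le hq)

/-- For a position `i` with `i + d` beyond `q`, move both `i` and `i + d` back by the period `e`,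
apply the period `d` inductively there, and return. The overlap `d + e` keeps both shifts inside the
second factor. -/
theorem PeriodicOn.union {w : List A} {p q r t d e : ℕ} (h : PeriodicOn w p q d)
    (h' : PeriodicOn w r t e) (he : 0 < e) (hpr : p ≤ r) (hov : r + d + e ≤ q) :
    PeriodicOn w p t d := by
  intro i
  induction i using Nat.strong_induction_on with
  | _ i ih =>
    intro hi hit
    by_cases hq : i + d < q
    · exact h i hi hq
    · have h1 := h' (i - e) (by omega) (by omega)
      have h2 := h' (i + d - e) (by omega) (by omega)
      have h3 := ih (i - e) (by omega) (by omega) (by omega)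
      rw [show i - e + e = i by omega] at h1
      rw [show i + d - e + e = i + d by omega] at h2
      rw [show i - e + d = i + d - e by omega] at h3
      rw [← h1, h3, h2]

/-- For large `k` the word `P Q^k` is longer than `u`, so `u` is a prefix of it. -/
theorem periodicOn_of_prefix {u P Q : List A} {r : ℕ → List A} (hQ : Q ≠ [])
    (h : ∀ k, P ++ (List.replicate k Q).flatten <+: u ++ r k) :
    PeriodicOn u P.length u.length Q.length := by
  intro i hi hiu
  have hQ' := List.length_pos_of_ne_nil hQ
  set S := (List.replicate u.length Q).flatten with hS
  have hSl : u.length ≤ S.length := by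
    simp [hS]
    exact Nat.le_mul_of_pos_right _ hQ'
  have hk := h (u.length + 1)
  have hu : ∀ m, m < u.length → u[m]? = (P ++ (List.replicate (u.length + 1) Q).flatten)[m]? := by
    intro m hm
    rw [List.prefix_iff_getElem?] at hk
    have hm' : m < (P ++ (List.replicate (u.length + 1) Q).flatten).length := by
      rw [List.replicate_succ, List.flatten_cons, ← hS]
      simp
      omega
    have := hk m hm'
    rw [List.getElem?_append_left hm] at this
    rw [this, List.getElem?_eq_getElem hm']
  rw [hu i (by omega), hu (i + Q.length) hiu]
  rw [List.getElem?_append_right hi, List.getElem?_append_right (by omega)]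
  rw [show i + Q.length - P.length = (i - P.length) + Q.length by omega]
  conv_rhs => rw [List.replicate_succ, List.flatten_cons]
  rw [List.getElem?_append_right (by omega), Nat.add_sub_cancel]
  have hc : (List.replicate (u.length + 1) Q).flatten = S ++ Q := by
    rw [List.replicate_succ', List.flatten_append]
    simp [hS]
  rw [hc, List.getElem?_append_left (by omega)]

theorem periodicOn_of_suffix {u v P Q : List A} {r : ℕ → List A} (hQ : Q ≠ [])
    (h : ∀ k, (List.replicate k Q).flatten ++ P <:+ r k ++ u) :
    PeriodicOn (v ++ u) v.length ((v ++ u).length - P.length) Q.length := by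
  have h1 : PeriodicOn u.reverse P.length u.length Q.length := by
    have := periodicOn_of_prefix (u := u.reverse) (P := P.reverse) (Q := Q.reverse)
      (r := fun k => (r k).reverse) (by simpa using hQ) (fun k => by
        have := h k
        rw [← List.reverse_prefix, List.reverse_append, List.reverse_append,
          Subst.reverse_flatten_replicate] at this
        exact this)
    simpa using this
  intro i hi hiu
  simp at hiu
  have h2 := h1 (u.length - 1 - (i - v.length) - Q.length) (by omega) (by omega)
  rw [List.getElem?_reverse (by omega), List.getElem?_reverse (by omega)] at h2
  rw [List.getElem?_append_right hi, List.getElem?_append_right (by omega)]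
  rw [show u.length - 1 - (u.length - 1 - (i - v.length) - Q.length) = i + Q.length - v.length
    by omega] at h2
  rw [show u.length - 1 - (u.length - 1 - (i - v.length) - Q.length + Q.length) = i - v.length
    by omega] at h2
  exact h2.symm

theorem getElem?_flatten_replicate (r : List A) (n i : ℕ)
    (h : i + r.length < n * r.length) :
    (List.replicate n r).flatten[i]? = (List.replicate n r).flatten[i + r.length]? := by
  cases n with
  | zero => omega
  | succ n =>
    conv_rhs => rw [List.replicate_succ, List.flatten_cons]
    rw [List.getElem?_append_right (by omega), Nat.add_sub_cancel, List.replicate_succ',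
      List.flatten_append, List.getElem?_append_left]
    rw [Nat.succ_mul] at h
    simp
    omega

theorem rootLength_le_iff {p : List A} {l : ℕ} : rootLength p ≤ l ↔
    ∃ (r : List A) (n : ℕ), 0 < n ∧ p = (List.replicate n r).flatten ∧ r.length ≤ l := by
  have hne : Set.Nonempty {m : ℕ | ∃ (r : List A) (n : ℕ), 0 < n ∧
      p = (List.replicate n r).flatten ∧ r.length = m} := ⟨p.length, p, 1, one_pos, by simp, rfl⟩
  constructor
  · intro h
    obtain ⟨r, n, hn, hp, hr⟩ := Nat.sInf_mem hne
    exact ⟨r, n, hn, hp, hr.le.trans h⟩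
  · rintro ⟨r, n, hn, hp, hr⟩
    have : rootLength p ≤ r.length := Nat.sInf_le ⟨r, n, hn, hp, rfl⟩
    exact this.trans hr

theorem take_eq_flatten_replicate {w : List A} {d n : ℕ} (hn : n * d ≤ w.length)
    (h : PeriodicOn w 0 (n * d) d) :
    w.take (n * d) = (List.replicate n (w.take d)).flatten := by
  induction n with
  | zero => simp
  | succ n ih =>
    rcases Nat.eq_zero_or_pos n with rfl | hpos
    · simp
    have hs : (n + 1) * d = d + n * d := by ring
    have hd : d ≤ n * d := Nat.le_mul_of_pos_left _ hpos
    rw [hs] at hn h ⊢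
    rw [List.replicate_succ, List.flatten_cons, ← ih (by omega) (h.mono le_rfl (by omega)),
      List.take_add]
    congr 1
    apply List.ext_getElem?
    intro i
    rw [List.getElem?_take, List.getElem?_take]
    split_ifs with hi
    · rw [List.getElem?_drop, add_comm]
      exact (h i (Nat.zero_le _) (by omega)).symm
    · rfl

theorem exists_of_mem_cuts {l : ℕ} {w : List A} {j : ℕ} (h : j ∈ cuts l w) :
    ∃ c, c ≤ j ∧ j ≤ w.length ∧ firstFactorLength l (w.drop c) = j - c ∧ c < j := by
  rw [cuts, List.mem_toFinset, List.mem_map] at h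
  obtain ⟨fs, hfs, rfl⟩ := h
  induction w using factors.induct l generalizing fs with
  | case1 w h0 =>
    rw [factors, dif_pos h0] at hfs
    simp at hfs
  | case2 w h0 ih =>
    rw [factors, dif_neg h0] at hfs
    simp only [List.inits_cons, List.tail_cons, List.mem_map] at hfs
    obtain ⟨gs, hgs, rfl⟩ := hfs
    have hle : firstFactorLength l w ≤ w.length := Nat.findGreatest_le _
    cases hf : factors l (w.drop (firstFactorLength l w)) with
    | nil =>
      rw [hf] at hgs
      simp at hgs
      subst hgs
      refine ⟨0, ?_⟩
      simp
      omega
    | cons f ft =>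
      rw [hf, List.inits_cons, List.mem_cons] at hgs
      rcases hgs with rfl | hgs
      · refine ⟨0, ?_⟩
        simp
        omega
      · obtain ⟨c, h1, h2, h3, h4⟩ := ih gs (by rw [hf, List.inits_cons]; exact hgs)
        refine ⟨firstFactorLength l w + c, ?_⟩
        rw [List.drop_drop] at h3
        rw [List.length_drop] at h2
        rw [List.flatten_cons, List.length_append, List.length_take_of_le hle]
        exact ⟨by omega, by omega, by omega, by omega⟩

/-- Inside a factor of small period, there are no cuts far from its ends. -/
theorem PeriodicOn.not_mem_cuts {w : List A} {p q d l j : ℕ} (h : PeriodicOn w p q d)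
    (hd : 0 < d) (hdl : d ≤ l) (hq : q ≤ w.length) (hpj : p + 2 * l ≤ j) (hjq : j + l ≤ q) :
    j ∉ cuts l w := by
  intro hj
  obtain ⟨c, -, hjw, hf, hcj⟩ := exists_of_mem_cuts hj
  -- If a small period reached from the start `c` of the factor to `q`, the greedy factor would
  -- extend to the last multiple of `e` before `q`; that is beyond `j` because `q - j ≥ l ≥ e`.
  have key : ∀ e, 0 < e → e ≤ l → ¬ PeriodicOn w c q e := by
    intro e he hel hper
    set n := (q - c) / e with hn
    have h1 : n * e ≤ q - c := Nat.div_mul_le_self _ _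
    have h2 : q - c < n * e + e := by
      have := Nat.lt_div_mul_add (a := q - c) he
      omega
    have hpos : 0 < n := Nat.div_pos (by omega) he
    have hper' : PeriodicOn (w.drop c) 0 (n * e) e := by
      intro i _ hi
      rw [List.getElem?_drop, List.getElem?_drop, ← add_assoc]
      exact hper (c + i) (by omega) (by omega)
    have htake := take_eq_flatten_replicate (by simp; omega) hper'
    have hroot : rootLength ((w.drop c).take (n * e)) ≤ l :=
      rootLength_le_iff.2 ⟨_, n, hpos, htake, by simp; omega⟩
    have := Nat.le_findGreatest (P := fun n => rootLength ((w.drop c).take n) ≤ l)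
      (n := (w.drop c).length) (m := n * e) (by simp; omega) hroot
    rw [← firstFactorLength, hf] at this
    omega
  rcases le_or_gt p c with hpc | hcp
  · exact key d hd hdl (h.mono hpc le_rfl)
  -- The factor ending at `j` starts before `p`. Its own root gives it a small period, which extends
  -- to `q` because the overlap from `p` to `j` has length at least `2 * l`.
  · have hspec := Nat.findGreatest_of_ne_zero
      (P := fun n => rootLength ((w.drop c).take n) ≤ l) (n := (w.drop c).length)
      (m := j - c) (by rw [← firstFactorLength, hf]) (by omega)
    obtain ⟨r, n, hn, hr, hrl⟩ := rootLength_le_iff.1 hspec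
    have hlen : j - c = n * r.length := by
      have := congrArg List.length hr
      simp at this
      omega
    have hrpos : 0 < r.length := by
      rcases Nat.eq_zero_or_pos r.length with h0 | h0
      · rw [h0] at hlen; omega
      · exact h0
    have hper : PeriodicOn w c j r.length := by
      intro i hi hij
      have h1 := getElem?_flatten_replicate r n (i - c) (by omega)
      rw [← hr, List.getElem?_take_of_lt (by omega), List.getElem?_take_of_lt (by omega),
        List.getElem?_drop, List.getElem?_drop] at h1
      rwa [show c + (i - c) = i by omega, show c + (i - c + r.length) = i + r.length by omega]
        at h1
    exact key _ hrpos hrl (hper.union h hd hcp.le (by omega))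

end Periods

namespace Subst

/-! ### Append-only sequences -/

section AppendOnlySequences

variable {X : Type*} {A : Type*}

theorem appendOnly_compSeq {O : X} {s : List (Subst X A)}
    (h : ∀ σ ∈ s, SST.AppendOnly O σ) : SST.AppendOnly O (compSeq s) := by
  induction s with
  | nil => exact ⟨[], rfl⟩
  | cons σ s ih =>
    obtain ⟨y, hy⟩ := h σ (by simp)
    obtain ⟨z, hz⟩ := ih fun τ hτ => h τ (by simp [hτ])
    refine ⟨y ++ z, ?_⟩
    have h1 : compSeq (σ :: s) O = ext σ (compSeq s O) := rfl
    have h2 : ext σ (z.map Sum.inr) = z.map Sum.inr := by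
      apply ext_of_vars_eq_nil
      simp [vars, List.filterMap_map]
    rw [h1, hz, ext_cons_inl, hy, h2]
    simp

theorem ev_map_inr (f : X → List A) (z : List A) : ev f (z.map Sum.inr) = z := by
  induction z with
  | nil => rfl
  | cons a z ih => simp [ih]

theorem outp_append_of_appendOnly {O : X} {s t : List (Subst X A)}
    (ht : ∀ σ ∈ t, SST.AppendOnly O σ) : outp O (s ++ t) = outp O s ++ outp O t := by
  obtain ⟨z, hz⟩ := appendOnly_compSeq ht
  rw [outp_append, outp_eq_ev O t, hz]
  simp [ev_map_inr]

/-- What the first `t` substitutions produce is a prefix of the output. -/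
theorem weight_of_appendOnly {O : X} {s : List (Subst X A)} (hs : ∀ σ ∈ s, SST.AppendOnly O σ)
    {j t : ℕ} (ht : t ≤ s.length) :
    weight O s j t = min j (outp O (s.take t)).length := by
  obtain ⟨z, hz⟩ := appendOnly_compSeq (s := s.drop t) fun σ hσ => hs σ (List.mem_of_mem_drop hσ)
  have h1 : weight O s j t = ((tags (val s t) (tailWord O s t)).take j).countP id := by
    rw [← map_originWord O s ht, ← List.map_take, List.countP_map]
    rfl
  have h2 : ∀ z : List A, tags (val s t) (z.map Sum.inr) = List.replicate z.length false := by
    intro z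
    induction z with
    | nil => rfl
    | cons a z ih =>
      rw [List.length_cons, List.replicate_succ, ← ih]
      rfl
  have h3 : tags (val s t) (tailWord O s t) =
      List.replicate (outp O (s.take t)).length true ++ List.replicate z.length false := by
    rw [tailWord, hz, ← h2]
    rfl
  rw [h1, h3, List.take_append, List.countP_append, List.take_replicate, List.take_replicate,
    List.countP_replicate, List.countP_replicate]
  simp

theorem weight_length_eq (O : X) (s : List (Subst X A)) {j : ℕ} (hj : j ≤ (outp O s).length) :
    weight O s j s.length = j := by
  have h := weight_add_lc O s le_rfl (le_refl (outp O s).length)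
  have h0 : tailWord O s s.length = [Sum.inl O] := by
    rw [tailWord, List.drop_length]
    rfl
  rw [h0] at h
  simp at h
  have h1 := weight_le_add_sub O s hj s.length
  have h2 := weight_le O s j s.length
  omega

theorem weight_zero (O : X) (s : List (Subst X A)) (j : ℕ) : weight O s j 0 = 0 := by
  have h := weight_add_lc O s (Nat.zero_le _) (le_max_left (outp O s).length j)
  have h0 : (outp O s).length = lc (tailWord O s 0) := by
    rw [outp_eq_ev_val O s 0, length_ev]
    have : ∀ x, val s 0 x = [] := fun x => rfl
    simp [this]
  have h1 := weight_mono_left O s (le_max_right (outp O s).length j) 0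
  omega

end AppendOnlySequences

end Subst

theorem exists_uniform_bound {Θ : Type*} [Finite Θ] (P : Θ → ℕ → Prop) :
    ∃ C, ∀ θ, (∃ n, P θ n) → ∃ n ≤ C, P θ n := by
  classical
  obtain ⟨C, hC⟩ := Finite.exists_le fun θ => if h : ∃ n, P θ n then h.choose else 0
  refine ⟨C, fun θ h => ⟨h.choose, ?_, h.choose_spec⟩⟩
  have := hC θ
  rwa [dif_pos h] at this

/-! ### Runs, their decompositions and bounded replacements -/

namespace SST

open Subst

variable {A : Type u}

section Runs

variable {T : SST.{u, v} A}

theorem Run.append {p q r : T.State} {x y : List A} {s t : List (Subst T.Var A)}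
    (h : T.Run p x q s) (h' : T.Run q y r t) : T.Run p (x ++ y) r (s ++ t) := by
  induction h with
  | nil => exact h'
  | cons he _ ih => exact Run.cons he (ih h')

theorem Run.length_eq {p q : T.State} {x : List A} {s : List (Subst T.Var A)}
    (h : T.Run p x q s) : s.length = x.length := by
  induction h with
  | nil => rfl
  | cons he _ ih => simp [ih]

theorem Run.replicate {p : T.State} {x : List A} {s : List (Subst T.Var A)}
    (h : T.Run p x p s) (n : ℕ) :
    T.Run p (List.replicate n x).flatten p (List.replicate n s).flatten := by
  induction n with
  | zero => exact Run.nil p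
  | succ n ih =>
    rw [List.replicate_succ, List.replicate_succ]
    exact h.append ih

theorem Run.forall_mem {p q : T.State} {x : List A} {s : List (Subst T.Var A)}
    (h : T.Run p x q s) {P : Subst T.Var A → Prop} (hP : ∀ e ∈ T.trans, P (T.update e)) :
    ∀ σ ∈ s, P σ := by
  induction h with
  | nil => simp
  | cons he _ ih => simpa using ⟨hP _ he, ih⟩

theorem Run.exists_states {p r : T.State} {x : List A} {s : List (Subst T.Var A)}
    (h : T.Run p x r s) : ∃ q : ℕ → T.State, q 0 = p ∧ q x.length = r ∧
      ∀ i j, i ≤ j → j ≤ x.length →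
        T.Run (q i) ((x.drop i).take (j - i)) (q j) (seg s i j) := by
  induction h with
  | nil q =>
    refine ⟨fun _ => q, rfl, rfl, fun i j _ _ => ?_⟩
    simpa [seg] using Run.nil q
  | @cons p q₁ r a x s he hr ih =>
    obtain ⟨q, rfl, hq, hrun⟩ := ih
    refine ⟨fun i => Nat.casesOn i p q, rfl, hq, fun i j hij hj => ?_⟩
    cases i with
    | zero =>
      cases j with
      | zero => simpa [seg] using Run.nil p
      | succ j =>
        have := hrun 0 j (Nat.zero_le _) (by simpa using hj)
        exact Run.cons he this
    | succ i =>
      cases j with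
      | zero => omega
      | succ j =>
        have := hrun i j (by omega) (by simpa using hj)
        simpa [seg] using this

/-- The properties of an accepting run that pumping arguments use. -/
theorem exists_states_of_mem_lang {x : List A} {s : List (Subst T.Var A)}
    (h : (x, s) ∈ T.lang) : s.length = x.length + 1 ∧ ∃ q : ℕ → T.State,
      q 0 ∈ T.initial ∧ q x.length ∈ T.accepting ∧
      (∀ i ≤ x.length, T.Run (q 0) (x.take i) (q i) (s.take i)) ∧
      (∀ i j, i ≤ j → j ≤ x.length →
        T.Run (q i) ((x.drop i).take (j - i)) (q j) (seg s i j)) ∧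
      ∀ i ≤ x.length, ∃ t, T.Run (q i) (x.drop i) (q x.length) t ∧
        s.drop i = t ++ [T.finalUpdate (q x.length)] := by
  obtain ⟨q₀, hq₀, q₁, hq₁, t, hrun, hs⟩ := h
  simp only at hrun hs
  subst hs
  have hlen := hrun.length_eq
  obtain ⟨q, rfl, rfl, hq⟩ := hrun.exists_states
  have hseg : ∀ i j, i ≤ j → j ≤ x.length →
      seg (t ++ [T.finalUpdate (q x.length)]) i j = seg t i j := by
    intro i j hij hj
    rw [seg, seg, List.drop_append_of_le_length (by omega), List.take_append_of_le_length]
    simp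
    omega
  refine ⟨by simp [hlen], q, hq₀, hq₁, fun i hi => ?_, fun i j hij hj => ?_, fun i hi => ?_⟩
  · have := hq 0 i (Nat.zero_le _) hi
    rw [List.take_append_of_le_length (by omega)]
    exact this
  · rw [hseg i j hij hj]
    exact hq i j hij hj
  · refine ⟨t.drop i, ?_, by rw [List.drop_append_of_le_length (by omega)]⟩
    have := hq i x.length hi le_rfl
    rw [seg, List.take_of_length_le (by simp), List.take_of_length_le (by simp; omega)] at this
    exact this

theorem forall_mem_of_mem_lang {x : List A} {s : List (Subst T.Var A)} (h : (x, s) ∈ T.lang)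
    {P : Subst T.Var A → Prop} (hP : ∀ e ∈ T.trans, P (T.update e))
    (hP' : ∀ q, P (T.finalUpdate q)) : ∀ σ ∈ s, P σ := by
  obtain ⟨q₀, -, q₁, -, t, hrun, hs⟩ := h
  simp only at hrun hs
  subst hs
  intro σ hσ
  rw [List.mem_append, List.mem_singleton] at hσ
  rcases hσ with hσ | rfl
  · exact hrun.forall_mem hP σ hσ
  · exact hP' _

theorem copyless_of_mem_lang {x : List A} {s : List (Subst T.Var A)} (h : (x, s) ∈ T.lang) :
    ∀ σ ∈ s, σ.Copyless :=
  forall_mem_of_mem_lang h T.update_copyless T.finalUpdate_copyless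

theorem IsRational.appendOnly_of_mem_lang (hT : T.IsRational) {x : List A}
    {s : List (Subst T.Var A)} (h : (x, s) ∈ T.lang) : ∀ σ ∈ s, AppendOnly T.outVar σ :=
  forall_mem_of_mem_lang h hT.2.1 hT.2.2

theorem exists_adds_of_mem_lang [Finite A] (T : SST.{u, v} A) :
    ∃ D, ∀ x s, (x, s) ∈ T.lang → ∀ σ ∈ s, Adds D σ := by
  have := T.finite_state
  have := T.finite_var
  choose f hf using fun e => exists_adds (T.update e)
  choose g hg using fun q => exists_adds (T.finalUpdate q)
  obtain ⟨M, hM⟩ := Finite.exists_le f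
  obtain ⟨M', hM'⟩ := Finite.exists_le g
  refine ⟨max M M', fun x s h => forall_mem_of_mem_lang h
    (fun e _ => (hf e).mono ((hM e).trans (le_max_left _ _)))
    (fun q => (hg q).mono ((hM' q).trans (le_max_right _ _)))⟩

end Runs

section Pairs

variable {T : SST.{u, v} A} {T' : SST.{u, w} A}

theorem outp_eq_of_equivalent (hT : T.Functional) (h : T.Equivalent T') {x : List A}
    {s : List (Subst T.Var A)} {s' : List (Subst T'.Var A)} (hs : (x, s) ∈ T.lang)
    (hs' : (x, s') ∈ T'.lang) : outp T.outVar s = outp T'.outVar s' := by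
  refine hT x _ _ ⟨s, hs, rfl⟩ ?_
  rw [h]
  exact ⟨s', hs', rfl⟩

/-- Equivalent transducers produce almost the same amount of output on every prefix. -/
theorem exists_balance (hT : T.Functional) (hT' : T'.IsRational) (h : T.Equivalent T') :
    ∃ C, ∀ x s s', (x, s) ∈ T.lang → (x, s') ∈ T'.lang → ∀ t ≤ x.length,
      weight T.outVar s (outp T.outVar s).length t ≤ (outp T'.outVar (s'.take t)).length + C ∧
      (outp T'.outVar (s'.take t)).length ≤ weight T.outVar s (outp T.outVar s).length t + C := by
  have := T.finite_state
  have := T.finite_var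
  have := T'.finite_state
  let W : T.State → List (Subst T.Var A) → List (T.Var ⊕ A) := fun q t =>
    compSeq (t ++ [T.finalUpdate q]) T.outVar
  -- Only the two states and the set of variables of the tail word matter; for each of these
  -- finitely many types one common continuation is fixed, and `C` bounds what it adds.
  obtain ⟨C, hC⟩ := exists_uniform_bound
    fun (θ : T.State × T'.State × (T.Var → Prop)) (n : ℕ) =>
      ∃ y q q' t t', T.Run θ.1 y q t ∧ q ∈ T.accepting ∧ T'.Run θ.2.1 y q' t' ∧
        q' ∈ T'.accepting ∧ (∀ x, Sum.inl x ∈ W q t ↔ θ.2.2 x) ∧ lc (W q t) ≤ n ∧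
        (outp T'.outVar (t' ++ [T'.finalUpdate q'])).length ≤ n
  refine ⟨C, fun x s s' hs hs' i hi => ?_⟩
  obtain ⟨hlen, q, hq0, hqa, hpre, -, hsuf⟩ := exists_states_of_mem_lang hs
  obtain ⟨hlen', q', hq0', hqa', hpre', -, hsuf'⟩ := exists_states_of_mem_lang hs'
  obtain ⟨t, ht, hst⟩ := hsuf i hi
  obtain ⟨t', ht', hst'⟩ := hsuf' i hi
  obtain ⟨n, hn, y, r, r', tr, tr', h1, h2, h3, h4, h5, h6, h7⟩ :=
    hC (q i, q' i, fun z => Sum.inl z ∈ W (q x.length) t)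
      ⟨_, x.drop i, _, _, t, t', ht, hqa, ht', hqa', fun _ => Iff.rfl, le_max_left _ _,
        le_max_right _ _⟩
  simp only at h1 h3 h5
  have hl : (x.take i ++ y, s.take i ++ (tr ++ [T.finalUpdate r])) ∈ T.lang :=
    ⟨q 0, hq0, r, h2, s.take i ++ tr, (hpre i hi).append h1, by simp⟩
  have hl' : (x.take i ++ y, s'.take i ++ (tr' ++ [T'.finalUpdate r'])) ∈ T'.lang :=
    ⟨q' 0, hq0', r', h4, s'.take i ++ tr', (hpre' i hi).append h3, by simp⟩
  have e := congrArg List.length (outp_eq_of_equivalent hT h hl hl')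
  have hap := hT'.appendOnly_of_mem_lang hl'
  rw [outp_append, outp_append_of_appendOnly
    (fun σ hσ => hap σ (List.mem_append_right _ hσ)), length_ev, List.length_append] at e
  have hW : tailWord T.outVar s i = W (q x.length) t := by rw [tailWord, hst]
  -- The new continuation uses the same variables, each once. Their values have total length equal
  -- to the weight at time `i`, so equating the two output lengths compares it with the output of
  -- `T'`.
  have hperm : (vars (W r tr)).Perm (vars (tailWord T.outVar s i)) := by
    rw [List.perm_ext_iff_of_nodup]
    · intro z
      rw [mem_vars, mem_vars, hW, h5]
    · have hc := copyless_of_mem_lang hl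
      exact (copyless_compSeq fun σ hσ => hc σ (List.mem_append_right _ hσ)).1 _
    · exact nodup_vars_tailWord _ (copyless_of_mem_lang hs) i
  have hsum := (hperm.map fun z => (outp z (s.take i)).length).sum_eq
  have hF := weight_add_lc T.outVar s (t := i) (by omega) le_rfl
  have hlenF := congrArg List.length (outp_eq_ev_val T.outVar s i)
  rw [length_ev] at hlenF
  have hval : ∀ z, (val s i z).length = (outp z (s.take i)).length := fun z => rfl
  simp only [hval] at hlenF
  have e' : lc (W r tr) + ((vars (W r tr)).map fun z => (outp z (s.take i)).length).sum =
    (outp T'.outVar (s'.take i)).length +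
      (outp T'.outVar (tr' ++ [T'.finalUpdate r'])).length := e
  omega

/-- A factor between two visits of the same pair of states can be replaced by any number of copies
of a bounded factor of the same shape. -/
theorem exists_short_loop (hT : T.Functional) (hT' : T'.IsRational) (h : T.Equivalent T') :
    ∃ L, ∀ x s s', (x, s) ∈ T.lang → (x, s') ∈ T'.lang → ∃ q : ℕ → T.State × T'.State,
      ∀ i j, i ≤ j → j ≤ x.length → q i = q j → ∃ σ : Subst T.Var A, σ.Copyless ∧
        shape σ = shape (compSeq (seg s i j)) ∧ Adds L σ ∧ ∃ u : ℕ → List A, ∀ k,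
          ev (val s i) ((Subst.ext σ)^[k] (tailWord T.outVar s i)) =
            outp T'.outVar (s'.take i) ++ (u k ++ outp T'.outVar (s'.drop i)) := by
  have := T.finite_state
  have := T.finite_var
  have := T'.finite_state
  obtain ⟨L, hL⟩ := exists_uniform_bound
    fun (θ : T.State × T'.State × (T.Var → T.Var → Prop) × (T.Var → Prop) × (T.Var → Prop))
      (n : ℕ) => ∃ y t t', T.Run θ.1 y θ.1 t ∧ T'.Run θ.2.1 y θ.2.1 t' ∧
        shape (compSeq t) = θ.2.2 ∧ Adds n (compSeq t)
  refine ⟨L, fun x s s' hs hs' => ?_⟩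
  obtain ⟨hlen, q, hq0, hqa, hpre, hmid, hsuf⟩ := exists_states_of_mem_lang hs
  obtain ⟨hlen', q', hq0', hqa', hpre', hmid', hsuf'⟩ := exists_states_of_mem_lang hs'
  refine ⟨fun i => (q i, q' i), fun i j hij hj hqq => ?_⟩
  rw [Prod.mk.injEq] at hqq
  have hm := hmid i j hij hj
  have hm' := hmid' i j hij hj
  rw [← hqq.1] at hm
  rw [← hqq.2] at hm'
  obtain ⟨n₀, hn₀⟩ := exists_adds (compSeq (seg s i j))
  obtain ⟨n, hn, y, t, t', h1, h2, h3, h4⟩ := hL (q i, q' i, shape (compSeq (seg s i j)))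
    ⟨n₀, _, _, _, hm, hm', rfl, hn₀⟩
  simp only at h1 h2 h3
  refine ⟨compSeq t, copyless_compSeq (h1.forall_mem T.update_copyless), h3, h4.mono hn,
    fun k => outp T'.outVar (List.replicate k t').flatten, fun k => ?_⟩
  have hi : i ≤ x.length := hij.trans hj
  obtain ⟨r, hr, hsr⟩ := hsuf i hi
  obtain ⟨r', hr', hsr'⟩ := hsuf' i hi
  -- The short loops are inserted at time `i` and the original segment is kept, so `k = 0` gives
  -- back the original output.
  have hl : (x.take i ++ ((List.replicate k y).flatten ++ x.drop i),
      s.take i ++ ((List.replicate k t).flatten ++ s.drop i)) ∈ T.lang :=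
    ⟨q 0, hq0, _, hqa, s.take i ++ ((List.replicate k t).flatten ++ r),
      (hpre i hi).append ((h1.replicate k).append hr), by simp [hsr]⟩
  have hl' : (x.take i ++ ((List.replicate k y).flatten ++ x.drop i),
      s'.take i ++ ((List.replicate k t').flatten ++ s'.drop i)) ∈ T'.lang :=
    ⟨q' 0, hq0', _, hqa', s'.take i ++ ((List.replicate k t').flatten ++ r'),
      (hpre' i hi).append ((h2.replicate k).append hr'), by simp [hsr']⟩
  have e := outp_eq_of_equivalent hT h hl hl'
  have hap := hT'.appendOnly_of_mem_lang hl'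
  rw [outp_append_of_appendOnly (fun σ hσ => hap σ (List.mem_append_right _ hσ)),
    outp_append_of_appendOnly (fun σ hσ => hap σ
      (List.mem_append_right _ (List.mem_append_right _ hσ))), outp_append,
    compSeq_append] at e
  rw [← e]
  have hit : ∀ W, (Subst.ext (compSeq t))^[k] W =
      Subst.ext (compSeq (List.replicate k t).flatten) W := by
    intro W
    clear hl hl' e hap
    induction k with
    | zero => exact (ext_one W).symm
    | succ k ih =>
      rw [Function.iterate_succ_apply', ih, List.replicate_succ, List.flatten_cons,
        compSeq_append, ext_comp]
  rw [hit]
  rfl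

end Pairs

end SST

/-! ### Bounding the delay -/

namespace SST

open Subst

variable {A : Type u}

section Delay

variable {T : SST.{u, v} A} {T' : SST.{u, w} A}

/-- A segment that produces many letters among the first `c` positions of the output yields a
periodic factor that starts at about `c` at the latest. -/
theorem exists_periodicOn_after (hT : T.Functional) (hT' : T'.IsRational)
    (h : T.Equivalent T') :
    ∃ l N, ∀ x s s' D c lo hi, (x, s) ∈ T.lang → (x, s') ∈ T'.lang → (∀ σ ∈ s, Adds D σ) →
      lo ≤ hi → hi ≤ x.length →
      weight T.outVar s c lo + N * (D + 1) ≤ weight T.outVar s c hi →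
      ∃ t d a, lo ≤ t ∧ t ≤ hi ∧ 0 < d ∧ d ≤ l ∧ a ≤ c + l ∧
        PeriodicOn (outp T.outVar s) a (outp T'.outVar (s'.take t)).length d := by
  have := T.finite_state
  have := T.finite_var
  have := T'.finite_state
  obtain ⟨L, hL⟩ := exists_short_loop hT hT' h
  obtain ⟨N, hN⟩ := exists_pump T.Var (T.State × T'.State)
  refine ⟨2 * L, N, fun x s s' D c lo hi hs hs' hD hlh hhi hw => ?_⟩
  obtain ⟨q, hq⟩ := hL x s s' hs hs'
  have hlen := (exists_states_of_mem_lang hs).1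
  obtain ⟨i, j, hi1, hij, hj, hqq, hpump⟩ := hN T.outVar s c D lo hi q
    (copyless_of_mem_lang hs) hD hlh (by omega) hw
  obtain ⟨σ, hσ, hsh, hLσ, u, hu⟩ := hq i j hij.le (hj.trans hhi) hqq
  obtain ⟨P, Q, hQ, hQL, hP, hk⟩ := hpump σ L hσ hsh hLσ
  refine ⟨i, Q.length, P.length, hi1, by omega, List.length_pos_of_ne_nil hQ, hQL, by omega, ?_⟩
  -- The output of `T'` before time `i` is unaffected by pumping, hence is a prefix of all pumped
  -- outputs.
  have hper := periodicOn_of_prefix hQ fun k => (hu (k + 1)) ▸ hk k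
  have h0 := hu 0
  rw [Function.iterate_zero, id, ← outp_eq_ev_val] at h0
  intro m hm hm'
  have := hper m hm hm'
  rw [h0, List.getElem?_append_left (by omega), List.getElem?_append_left (by omega)]
  exact this

/-- A segment that produces many letters among the last `c` positions of the output yields a
periodic factor that ends at most about `c` positions before the end. -/
theorem exists_periodicOn_before (hT : T.Functional) (hT' : T'.IsRational)
    (h : T.Equivalent T') :
    ∃ l N, ∀ x s s' D c lo hi, (x, s) ∈ T.lang → (x, s') ∈ T'.lang → (∀ σ ∈ s, Adds D σ) →
      lo ≤ hi → hi ≤ x.length →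
      weight T.outVar (s.map mirror) c lo + N * (D + 1) ≤ weight T.outVar (s.map mirror) c hi →
      ∃ t d a, lo ≤ t ∧ t ≤ hi ∧ 0 < d ∧ d ≤ l ∧ a ≤ c + l ∧
        PeriodicOn (outp T.outVar s) (outp T'.outVar (s'.take t)).length
          ((outp T.outVar s).length - a) d := by
  have := T.finite_state
  have := T.finite_var
  have := T'.finite_state
  obtain ⟨L, hL⟩ := exists_short_loop hT hT' h
  obtain ⟨N, hN⟩ := exists_pump_suffix T.Var (T.State × T'.State)
  refine ⟨2 * L, N, fun x s s' D c lo hi hs hs' hD hlh hhi hw => ?_⟩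
  obtain ⟨q, hq⟩ := hL x s s' hs hs'
  have hlen := (exists_states_of_mem_lang hs).1
  obtain ⟨i, j, hi1, hij, hj, hqq, hpump⟩ := hN T.outVar s c D lo hi q
    (copyless_of_mem_lang hs) hD hlh (by omega) hw
  obtain ⟨σ, hσ, hsh, hLσ, u, hu⟩ := hq i j hij.le (hj.trans hhi) hqq
  obtain ⟨P, Q, hQ, hQL, hP, hk⟩ := hpump σ L hσ hsh hLσ
  refine ⟨i, Q.length, P.length, hi1, by omega, List.length_pos_of_ne_nil hQ, hQL, by omega, ?_⟩
  have hu' : ∀ k, ev (val s i) ((Subst.ext σ)^[k] (tailWord T.outVar s i)) =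
      (outp T'.outVar (s'.take i) ++ u k) ++ outp T'.outVar (s'.drop i) := fun k => by
    rw [hu k, List.append_assoc]
  have h0 : outp T.outVar s = outp T'.outVar (s'.take i) ++ outp T'.outVar (s'.drop i) := by
    rw [outp_eq_of_equivalent hT h hs hs']
    conv_lhs => rw [← List.take_append_drop i s']
    exact outp_append_of_appendOnly fun σ hσ =>
      hT'.appendOnly_of_mem_lang hs' σ (List.mem_of_mem_drop hσ)
  rw [h0]
  exact periodicOn_of_suffix hQ fun k => (hu' (k + 1)) ▸ hk k

/-- The accepting runs of a functional transducer and of an equivalent rational one have bounded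
delay. -/
theorem exists_delay_le [Finite A] (hT : T.Functional) (hT' : T'.IsRational)
    (h : T.Equivalent T') :
    ∃ k l, 0 < l ∧ ∀ x s s', (x, s) ∈ T.lang → (x, s') ∈ T'.lang →
      s.length = s'.length ∧ ∀ j ∈ cuts l (outp T.outVar s), ∀ t ≤ s.length,
        weightDiff T.outVar T'.outVar s s' j t ≤ k := by
  obtain ⟨D, hD⟩ := exists_adds_of_mem_lang T
  obtain ⟨C, hC⟩ := exists_balance hT hT' h
  obtain ⟨l₁, N₁, hafter⟩ := exists_periodicOn_after hT hT' h
  obtain ⟨l₂, N₂, hbefore⟩ := exists_periodicOn_before hT hT' h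
  set l := l₁ + l₂ + 1 with hl
  set M₁ := N₁ * (D + 1) with hM₁
  set M₂ := N₂ * (D + 1) with hM₂
  refine ⟨10 * l + 3 * C + 2 * D + M₁ + M₂, l, by omega, fun x s s' hs hs' => ?_⟩
  have hlen := (exists_states_of_mem_lang hs).1
  have hlen' := (exists_states_of_mem_lang hs').1
  refine ⟨by omega, fun j hj t ht => ?_⟩
  have hout := outp_eq_of_equivalent hT h hs hs'
  have hap := hT'.appendOnly_of_mem_lang hs'
  obtain ⟨-, -, hjw, -⟩ := exists_of_mem_cuts hj
  -- At the final time everything is produced and both weights equal `j`. Balance and loops are only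
  -- available up to `x.length`, before the final substitution.
  rcases ht.eq_or_lt with rfl | ht
  · have h1 := weight_length_eq T.outVar s hjw
    have h2 := weight_length_eq T'.outVar s' (hout ▸ hjw)
    rw [← hlen.trans hlen'.symm] at h2
    rw [weightDiff, h1, h2]
    simp
  have hD' := hD x s hs
  have hcl := copyless_of_mem_lang hs
  have htx : t ≤ x.length := by omega
  set B : ℕ → ℕ := fun t => (outp T'.outVar (s'.take t)).length with hB
  set F : ℕ → ℕ := fun t => weight T.outVar s (outp T.outVar s).length t with hF
  have hBF : ∀ t ≤ x.length, F t ≤ B t + C ∧ B t ≤ F t + C := hC x s s' hs hs'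
  have hBmono : ∀ t t', t ≤ t' → B t ≤ B t' := by
    intro t t' htt
    simp only [hB]
    have hseg : ∀ σ ∈ seg s' t t', AppendOnly T'.outVar σ := fun σ hσ =>
      hap σ (List.mem_of_mem_drop (List.mem_of_mem_take hσ))
    rw [← take_append_seg s' htt, outp_append_of_appendOnly hseg]
    simp
  have hBw : ∀ t, B t ≤ (outp T.outVar s).length := by
    intro t
    rw [hout]
    conv_rhs => rw [← List.take_append_drop t s']
    rw [outp_append_of_appendOnly fun σ hσ => hap σ (List.mem_of_mem_drop hσ)]
    simp [hB]
  have hb : weight T'.outVar s' j t = min j (B t) :=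
    weight_of_appendOnly hap (by omega)
  have haj := weight_le T.outVar s j t
  have haF : weight T.outVar s j t ≤ F t := weight_mono_left _ _ hjw t
  have hBFt := hBF t htx
  rw [weightDiff, hb]
  set a := weight T.outVar s j t with ha
  by_contra hcon
  -- The difference has this sign because `a ≤ j` and `a ≤ F t ≤ B t + C`.
  have hgap : a + (10 * l + 3 * C + 2 * D + M₁ + M₂) < min j (B t) := by omega
  clear hcon
  -- a loop after time `t`
  set c := min j (B t) - 3 * l with hc
  have hcj : c ≤ j := by omega
  have hca : weight T.outVar s c t ≤ a := weight_mono_left _ _ hcj t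
  have hcend : c ≤ weight T.outVar s c x.length + D := by
    have h1 := weight_succ_le T.outVar hcl hD' c (t := x.length) (by omega)
    rwa [← hlen, weight_length_eq T.outVar s (hcj.trans hjw)] at h1
  -- Waiting until `2 * l + 2 * C` further letters are produced guarantees `B t + 2 * l ≤ B t₂`
  -- after two uses of balance; enough letters remain for a loop after `t₁`.
  obtain ⟨t₁, ht₁, ht₁x, hw₁, hw₁'⟩ := exists_between_of_increment_le
    (f := fun t => weight T.outVar s c t) (D := D) (M := 2 * l + 2 * C) htx
    (fun t _ ht => weight_succ_le T.outVar hcl hD' c (by omega)) (by omega)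
  obtain ⟨t₂, d₂, a₂, ht₂, ht₂x, hd₂, hd₂l, ha₂, hper₂⟩ := hafter x s s' D c t₁ x.length hs hs' hD'
    ht₁x le_rfl (by omega)
  have hB₂ : B t + 2 * l ≤ B t₂ := by
    have h1 := weight_increment_mono T.outVar s (hcj.trans hjw) ht₁
    have h2 := weight_mono T.outVar s (outp T.outVar s).length ht₂
    have h3 := (hBF t₂ ht₂x).1
    have h1' : weight T.outVar s c t₁ + F t ≤ weight T.outVar s c t + F t₁ := h1
    have h2' : F t₁ ≤ F t₂ := h2
    omega
  have hper₂' : PeriodicOn (outp T.outVar s) a₂ (B t + 2 * l) d₂ := hper₂.mono le_rfl hB₂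
  have hBw₂ := hBw t₂
  rcases le_or_gt j (B t) with hjB | hjB
  · exact hper₂'.not_mem_cuts hd₂ (by omega) (by omega) (by omega) (by omega) hj
  -- a loop before time `t`
  have hj2 := weight_mono_left T.outVar s (show j ≤ j + 2 * l by omega) t
  have hj2' := weight_le_add_sub T.outVar s (show j ≤ j + 2 * l by omega) t
  -- As `F t` is much larger than `a`, at least `2 * l` positions follow `j`, so the truncated
  -- subtractions below are exact.
  have hFj : F t ≤ a + ((outp T.outVar s).length - j) := weight_le_add_sub T.outVar s hjw t
  have hmir := weight_mirror T.outVar s (c := (outp T.outVar s).length - j - 2 * l) t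
  rw [show (outp T.outVar s).length - ((outp T.outVar s).length - j - 2 * l) = j + 2 * l by
    omega] at hmir
  have hmir' : weight T.outVar (s.map mirror) ((outp T.outVar s).length - j - 2 * l) t +
    weight T.outVar s (j + 2 * l) t = F t := hmir
  obtain ⟨t₃, d₃, a₃, -, ht₃, hd₃, hd₃l, ha₃, hper₃⟩ := hbefore x s s' D
    ((outp T.outVar s).length - j - 2 * l) 0 t hs hs' hD' (Nat.zero_le _) htx (by
      rw [weight_zero]
      omega)
  have hper₃' : PeriodicOn (outp T.outVar s) (B t) (j + l) d₃ :=
    hper₃.mono (hBmono _ _ ht₃) (by omega)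
  -- The two periodic factors share the positions from `B t` to `B t + 2 * l`, enough for both
  -- periods, and together reach `j + l`.
  exact (hper₂'.union hper₃' hd₃ (by omega) (by omega)).not_mem_cuts hd₂ (by omega) (by omega)
    (by omega) le_rfl hj

end Delay

theorem DelayEquivalent.equivalent {T : SST.{u, v} A} {T' : SST.{u, w} A} {k l : ℕ}
    (h : DelayEquivalent k l T T') : T.Equivalent T' := by
  ext ⟨x, y⟩
  constructor
  · rintro ⟨s, hs, rfl⟩
    obtain ⟨s', hs', -, ho, -⟩ := h.1 x s hs
    exact ⟨s', hs', ho.symm⟩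
  · rintro ⟨s, hs, rfl⟩
    obtain ⟨s', hs', -, ho, -⟩ := h.2 x s hs
    exact ⟨s', hs', ho.symm⟩

theorem exists_delayEquivalent [Finite A] {T : SST.{u, v} A} {T' : SST.{u, w} A}
    (hT : T.Functional) (hT' : T'.IsRational) (h : T.Equivalent T') :
    ∃ k l, 0 < l ∧ DelayEquivalent k l T T' := by
  obtain ⟨k, l, hl, hk⟩ := exists_delay_le hT hT' h
  refine ⟨k, l, hl, fun x s hs => ?_, fun x s' hs' => ?_⟩
  · have hmem : (x, outp T.outVar s) ∈ T'.transduction := h ▸ ⟨s, hs, rfl⟩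
    obtain ⟨s', hs', ho⟩ := hmem
    obtain ⟨hlen, hd⟩ := hk x s s' hs hs'
    refine ⟨s', hs', hlen, ho.symm, ?_⟩
    refine Finset.sup_le fun j hj => Finset.sup_le fun t ht => ?_
    exact hd j hj t (Finset.mem_Icc.1 ht).2
  · have hmem : (x, outp T'.outVar s') ∈ T.transduction := by
      rw [h]
      exact ⟨s', hs', rfl⟩
    obtain ⟨s, hs, ho⟩ := hmem
    obtain ⟨hlen, hd⟩ := hk x s s' hs hs'
    refine ⟨s, hs, hlen.symm, ho.symm, ?_⟩
    refine Finset.sup_le fun j hj => Finset.sup_le fun t ht => ?_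
    have := hd j (by simpa [ho] using hj) t (hlen ▸ (Finset.mem_Icc.1 ht).2)
    simp only [weightDiff] at this ⊢
    omega

end SST

theorem mainTheorem7 {A : Type u} [Finite A] (T : SST.{u, v} A) (hT : T.Functional) :
    ∃ k l : ℕ, 0 < l ∧
      ((∃ T' : SST.{u, 0} A, T'.IsRational ∧ T.Equivalent T') ↔
        ∃ T'' : SST.{u, 0} A, T''.IsRational ∧ SST.DelayEquivalent k l T T'') := by
  by_cases hex : ∃ T' : SST.{u, 0} A, T'.IsRational ∧ T.Equivalent T'
  · obtain ⟨T', hT', h⟩ := hex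
    obtain ⟨k, l, hl, hd⟩ := SST.exists_delayEquivalent hT hT' h
    exact ⟨k, l, hl, fun _ => ⟨T', hT', hd⟩, fun _ => ⟨T', hT', h⟩⟩
  · exact ⟨0, 1, one_pos, fun h => absurd h hex,
      fun ⟨T'', hT'', hd⟩ => absurd ⟨T'', hT'', hd.equivalent⟩ hex⟩
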